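/- **Problem.** Jobs $J_1,\dots,J_n$ have positive integer processing times $p_j$ and weights $w_j$ with $p_1/w_1\le\dots\le p_n/w_n$. Let $P_j=p_1+\dots+p_j$, $P=P_n$, $W=\sum_j w_j$, $w_{\max}=\max_j w_j$, $p_{\min}=\min_j p_j$. In the original schedule $\pi^*=(1,2,\dots,n)$ job $J_j$ completes at $C_j(\pi^*)=P_j$ and starts at $S_j(\pi^*)=P_{j-1}$. The single machine is unavailable during $[T_1,T_2]$, where $T_1<T_2$ are nonnegative integers with $p_{\min}\le T_1<P$, and $k\ge 0$ is an integer. A schedule $\sigma$ assigns to each job a starting time $S_j\ge 0$ and the completion time $C_j=S_j+p_j$; it is *feasible* if no two jobs overlap, every job satisfies $C_j\le T_1$ (earlier schedule) or $S_j\ge T_2$ (later schedule), and $|C_j-C_j(\pi^*)|\le k$ for all $j$. Its cost is $\sum_j w_jC_j$. Let $j_1=\min\{j: P_j>T_1\}$, and let $1\le a\le j_1$ with $T_2-S_a(\pi^*)\le k$. A feasible schedule is *constrained* if $J_a$ is the lowest-indexed job of the later schedule (that is, $J_1,\dots,J_{a-1}$ are in the earlier schedule) and $J_a$ starts at time $T_2$.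 **Algorithm Approx$(a,\epsilon)$.** Put $\delta=1+\frac{\epsilon}{2n}$, let $j_3$ be the largest $j$ with $C_j(\pi^*)-k\le T_1$ (and $0$ if there is none), and let $m=\max\{a,j_3\}$. A quadruple $(j;\ell^1,\ell^2;Z)$ describes a partial schedule of $J_1,\dots,J_j$ with largest completion time $\ell^1$ in the earlier schedule and $\ell^2$ in the later schedule and with total weighted completion time $Z$. Let $[L^1,U^1]=[p_{\min},T_1]$, $[L^2,U^2]=[T_2+p_a,T_2+P]$ and $[L^3,U^3]=[\sum_{i<a}w_iP_i+w_a(T_2+p_a),\ \sum_i w_iP_i+WT_2]$. Split each $[L^i,U^i]$ into the $r_i+1$ intervals $[L^i,L^i\delta],(L^i\delta,L^i\delta^2],\dots,(L^i\delta^{r_i},U^i]$, where $r_i=\lfloor\log_\delta(U^i/L^i)\rfloor$. The products of three such intervals, with the additional interval $[0,0]$ in the first coordinate, are the boxes; there is one set of boxes for each level $j=a,\dots,m$ and one for full schedules, all initially empty. A quadruple is saved in the box containing $(\ell^1,\ell^2,Z)$; if that box is occupied, the quadruple with the smaller $\ell^1$ is kept. Start with $(a;P_{a-1},T_2+p_a;L^3)$.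 For $j=a,\dots,m-1$, from each saved quadruple $(j;\ell^1,\ell^2;Z)$ generate: 1. $(j+1;\ \ell^1,\ \ell^2+p_{j+1};\ Z+w_{j+1}(\ell^2+p_{j+1}))$; 2. if $\ell^1+p_{j+1}\le T_1$ and $C_{j+1}(\pi^*)-(\ell^1+p_{j+1})\le k$: $(j+1;\ \ell^1+p_{j+1},\ \ell^2;\ Z+w_{j+1}(\ell^1+p_{j+1}))$; 3. if $\ell^1+p_{j+1}<C_{j+1}(\pi^*)-k\le T_1$: the full schedule in which $J_{j+1},\dots,J_{j_3}$ complete in the earlier schedule at the times $C_i(\pi^*)-k$ and $J_{j_3+1},\dots,J_n$ are processed consecutively from time $\ell^2$ on. Each quadruple of level $m$ is completed by processing $J_{m+1},\dots,J_n$ consecutively from time $\ell^2$ on. Among the saved full schedules one of smallest $Z$ is returned, and its starting times are recovered by backtracking. **Theorem.** For every such instance, every such $a$ and every $0<\epsilon\le 1$, Approx$(a,\epsilon)$ returns a value and a feasible constrained schedule whose total weighted completion time equals that value and is at most $(1+\epsilon)$ times the total weighted completion time of every feasible constrained schedule. On a unit-cost real RAM (arithmetic, comparisons, logarithms, rounding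 and memory accesses cost one step each) its running time is $$O\!\left(\frac{n^4}{\epsilon^3}\,\log (\max\{2,T_1\})\,\log(T_2+P)\,\log(w_{\max}P+WT_2)\right)$$ with an absolute implied constant. -/

import Mathlib

namespace Resched

/-! ## The rescheduling problem -/

/-- The data of an instance: jobs `J_1, …, J_n` with processing times `p j` and weights `w j`
(only the values at `1 ≤ j ≤ n` matter), the unavailability interval `[T₁, T₂]`, and the bound `k`
on the maximum time deviation. -/
structure Inst where
  n : ℕ
  p : ℕ → ℕ
  w : ℕ → ℕ
  T₁ : ℕ
  T₂ : ℕ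
  k : ℕ

namespace Inst

/-- Completion time of `J_j` in the original schedule `π* = (1, 2, …, n)`. -/
def origC (I : Inst) (j : ℕ) : ℕ := ∑ i ∈ Finset.Icc 1 j, I.p i

/-- Starting time of `J_j` in the original schedule `π*`. -/
def origS (I : Inst) (j : ℕ) : ℕ := ∑ i ∈ Finset.Ico 1 j, I.p i

/-- Total processing time `P`. -/
def P (I : Inst) : ℕ := ∑ j ∈ Finset.Icc 1 I.n, I.p j

/-- Total weight `W`. -/
def W (I : Inst) : ℕ := ∑ j ∈ Finset.Icc 1 I.n, I.w j

/-- Maximum weight. -/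
def wMax (I : Inst) : ℕ := (Finset.Icc 1 I.n).sup I.w

/-- The first job of `π*` completed strictly after `T₁`. -/
noncomputable def j₁ (I : Inst) : ℕ := sInf {j : ℕ | 1 ≤ j ∧ j ≤ I.n ∧ I.T₁ < I.origC j}

/-- The standing assumptions: positive integer data, jobs indexed in WSPT order,
`T₁ < T₂`, and `p_min ≤ T₁ < P`. -/
structure Valid (I : Inst) : Prop where
  p_pos : ∀ j, 1 ≤ j → j ≤ I.n → 0 < I.p j
  w_pos : ∀ j, 1 ≤ j → j ≤ I.n → 0 < I.w j
  wspt : ∀ i j, 1 ≤ i → i ≤ j → j ≤ I.n → (I.p i : ℝ) / I.w i ≤ (I.p j : ℝ) / I.w j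
  T₁_lt_T₂ : I.T₁ < I.T₂
  pMin_le : ∃ j, 1 ≤ j ∧ j ≤ I.n ∧ I.p j ≤ I.T₁
  T₁_lt_P : I.T₁ < I.P

/-- `J_a` is a candidate for the first job of the later schedule: it is one of `J_1, …, J_{j₁}`
and its time deviation `T₂ - S_a(π*)`, when started at `T₂`, is at most `k`. -/
def Candidate (I : Inst) (a : ℕ) : Prop :=
  1 ≤ a ∧ a ≤ I.j₁ ∧ (I.T₂ : ℤ) - (I.origS a : ℤ) ≤ (I.k : ℤ)

/-- `S j` (for `1 ≤ j ≤ n`) are the starting times of a feasible non-preemptive schedule: one job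
at a time, no job processed during `[T₁, T₂]`, and maximum time deviation at most `k`. -/
structure Feasible (I : Inst) (S : ℕ → ℝ) : Prop where
  nonneg : ∀ j, 1 ≤ j → j ≤ I.n → 0 ≤ S j
  disjoint : ∀ i j, 1 ≤ i → i ≤ I.n → 1 ≤ j → j ≤ I.n → i ≠ j →
    S i + I.p i ≤ S j ∨ S j + I.p j ≤ S i
  avoids : ∀ j, 1 ≤ j → j ≤ I.n → S j + I.p j ≤ I.T₁ ∨ I.T₂ ≤ S j
  deviation : ∀ j, 1 ≤ j → j ≤ I.n → |(S j + I.p j) - (I.origC j : ℝ)| ≤ I.k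

/-- The constraint of the subproblem: `J_a` is the lowest-indexed job of the later
schedule (so `J_1, …, J_{a-1}` all belong to the earlier schedule), and it starts at `T₂`. -/
structure StartsLater (I : Inst) (a : ℕ) (S : ℕ → ℝ) : Prop where
  start_eq : S a = I.T₂
  earlier : ∀ j, 1 ≤ j → j < a → S j + I.p j ≤ I.T₁

/-- Total weighted completion time. -/
noncomputable def cost (I : Inst) (S : ℕ → ℝ) : ℝ :=
  ∑ j ∈ Finset.Icc 1 I.n, (I.w j : ℝ) * (S j + I.p j)

end Inst

/-! ## Unit-cost real RAM

A computation carries the number of elementary steps it has made. The primitives below are the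
only steps of the algorithm: arithmetic, logarithm, rounding, comparison, one access to an
array cell, one linked-list cell, and one step per loop iteration each cost `1`; reserving memory
costs `1` per cell. -/

structure Timed (α : Type) where
  val : α
  time : ℕ

namespace Timed

instance : Monad Timed where
  pure x := ⟨x, 0⟩
  bind x f := ⟨(f x.val).val, x.time + (f x.val).time⟩

def tick : Timed Unit := ⟨(), 1⟩

noncomputable def add (x y : ℝ) : Timed ℝ := ⟨x + y, 1⟩
noncomputable def sub (x y : ℝ) : Timed ℝ := ⟨x - y, 1⟩
noncomputable def mul (x y : ℝ) : Timed ℝ := ⟨x * y, 1⟩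
noncomputable def div (x y : ℝ) : Timed ℝ := ⟨x / y, 1⟩
noncomputable def ln (x : ℝ) : Timed ℝ := ⟨Real.log x, 1⟩
noncomputable def floor (x : ℝ) : Timed ℕ := ⟨⌊x⌋₊, 1⟩
noncomputable def ceil (x : ℝ) : Timed ℕ := ⟨⌈x⌉₊, 1⟩
noncomputable def le (x y : ℝ) : Timed Bool := ⟨decide (x ≤ y), 1⟩
noncomputable def lt (x y : ℝ) : Timed Bool := ⟨decide (x < y), 1⟩

def addN (x y : ℕ) : Timed ℕ := ⟨x + y, 1⟩
def subN (x y : ℕ) : Timed ℕ := ⟨x - y, 1⟩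
def maxN (x y : ℕ) : Timed ℕ := ⟨max x y, 1⟩

def read (A : ℕ → ℝ) (i : ℕ) : Timed ℝ := ⟨A i, 1⟩
def write (A : ℕ → ℝ) (i : ℕ) (x : ℝ) : Timed (ℕ → ℝ) := ⟨Function.update A i x, 1⟩
noncomputable def newArray (m : ℕ) : Timed (ℕ → ℝ) := ⟨fun _ => 0, m⟩
def cons (x : ℝ) (l : List ℝ) : Timed (List ℝ) := ⟨x :: l, 1⟩

/-- Run `body i` for the `m` values `i = lo, lo + 1, …, lo + m - 1`, in this order. -/
def loop {σ : Type} (lo : ℕ) : ℕ → (ℕ → σ → Timed σ) → σ → Timed σ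
  | 0, _, s => pure s
  | m + 1, body, s => do
    let s ← loop lo m body s
    tick
    body (lo + m) s

end Timed

section Algorithm

open Timed

/-- A saved quadruple `(j; ℓ₁, ℓ₂; Z)`, together with the linked list of the completion times of
`J_j, J_{j-1}, …, J_a`, from which the schedule is backtracked. In a quadruple that describes
a full schedule, `j` is the index of the last job that has a cell in the list. -/
structure Quad where
  j : ℕ
  ℓ₁ : ℝ
  ℓ₂ : ℝ
  Z : ℝ
  comp : List ℝ

/-- The boxes `B_{i₁,i₂,i₃}` attached to one level; each is empty or holds one quadruple. -/
abbrev Table : Type := ℕ → ℕ → ℕ → Option Quad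

/-- The prefix sums of the original schedule, `p_min` and `j₃`. -/
structure Pre where
  /-- `P j = p_1 + … + p_j`, the completion time of `J_j` in `π*` -/
  P : ℕ → ℝ
  /-- `W j = w_1 + … + w_j` -/
  W : ℕ → ℝ
  /-- `Z j = w_1 P_1 + … + w_j P_j` -/
  Z : ℕ → ℝ
  sumP : ℝ
  sumW : ℝ
  sumZ : ℝ
  pMin : ℝ
  /-- the largest `j` with `C_j(π*) - k ≤ T₁` (`0` if there is none) -/
  j₃ : ℕ

/-- The subdivision into boxes: `δ` is `1 + ε/2n`, `Lᵢ` is the lower end of the `i`-th range,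
`mᵢ = rᵢ + 1` is the number of its subintervals. -/
structure Grid where
  lnδ : ℝ
  L₁ : ℝ
  L₂ : ℝ
  L₃ : ℝ
  m₁ : ℕ
  m₂ : ℕ
  m₃ : ℕ

/-- Everything that is fixed during the dynamic program. `last` is the last level before the
completion: `j₃`, or `a` if `j₃ < a`. -/
structure Ctx where
  p : ℕ → ℝ
  w : ℕ → ℝ
  T₁ : ℝ
  T₂ : ℝ
  k : ℝ
  n : ℕ
  last : ℕ
  pre : Pre
  grid : Grid

noncomputable def prepare (n : ℕ) (p w : ℕ → ℝ) (T₁ k : ℝ) : Timed Pre := do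
  let bound ← add T₁ k
  let p₁ ← read p 1
  let size ← addN n 1
  let A ← newArray size
  let B ← newArray size
  let D ← newArray size
  loop 1 n (fun j s => do
    let pj ← read p j
    let wj ← read w j
    let sumP ← add s.sumP pj
    let sumW ← add s.sumW wj
    let z ← mul wj sumP
    let sumZ ← add s.sumZ z
    let P ← write s.P j sumP
    let W ← write s.W j sumW
    let Z ← write s.Z j sumZ
    let smaller ← lt pj s.pMin
    let ok ← le sumP bound
    pure { P := P, W := W, Z := Z, sumP := sumP, sumW := sumW, sumZ := sumZ
           pMin := if smaller then pj else s.pMin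
           j₃ := if ok then j else s.j₃ })
    { P := A, W := B, Z := D, sumP := 0, sumW := 0, sumZ := 0, pMin := p₁, j₃ := 0 }

/-- `⌊log_δ (U / L)⌋ + 1` -/
noncomputable def pieces (lnδ L U : ℝ) : Timed ℕ := do
  let q ← div U L
  let l ← ln q
  let t ← div l lnδ
  let r ← floor t
  addN r 1

/-- Index of the subinterval of `[L, Lδ], (Lδ, Lδ²], (Lδ², Lδ³], …` that contains `x`. -/
noncomputable def locate (lnδ L x : ℝ) : Timed ℕ := do
  let q ← div x L
  let l ← ln q
  let t ← div l lnδ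
  let c ← ceil t
  maxN 1 c

/-- The `i`-th subinterval: `[L, Lδ]` for `i = 1` and `(Lδ^(i-1), Lδ^i]` for `i ≥ 2`. -/
def piece (δ L : ℝ) (i : ℕ) : Set ℝ :=
  {x | (i = 1 ∧ L ≤ x ∧ x ≤ L * δ) ∨ (2 ≤ i ∧ L * δ ^ (i - 1) < x ∧ x ≤ L * δ ^ i)}

theorem mem_piece_locate {δ L x : ℝ} (hδ : 1 < δ) (hL : 0 < L) (hx : L ≤ x) :
    x ∈ piece δ L (locate (Real.log δ) L x).val := by
  have hl : 0 < Real.log δ := Real.log_pos hδ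
  have hq : 0 < x / L := div_pos (hL.trans_le hx) hL
  have hval : (locate (Real.log δ) L x).val = max 1 ⌈Real.log (x / L) / Real.log δ⌉₊ := rfl
  have hup : ∀ m : ℕ, Real.log (x / L) / Real.log δ ≤ m → x ≤ L * δ ^ m := by
    intro m hm
    rw [div_le_iff₀ hl, ← Real.log_pow, Real.log_le_log_iff hq (by positivity),
      div_le_iff₀ hL] at hm
    linarith
  have hlow : ∀ m : ℕ, (m : ℝ) < Real.log (x / L) / Real.log δ → L * δ ^ m < x := by
    intro m hm
    rw [lt_div_iff₀ hl, ← Real.log_pow, Real.log_lt_log_iff (by positivity) hq,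
      lt_div_iff₀ hL] at hm
    linarith
  rw [hval]
  have hc := Nat.le_ceil (Real.log (x / L) / Real.log δ)
  generalize hcc : ⌈Real.log (x / L) / Real.log δ⌉₊ = c at hc ⊢
  rcases Nat.lt_or_ge c 2 with h | h
  · left
    have h1 : max 1 c = 1 := by omega
    refine ⟨h1, hx, ?_⟩
    have := hup 1 (hc.trans (by exact_mod_cast (by omega : c ≤ 1)))
    simpa using this
  · right
    have h1 : max 1 c = c := by omega
    rw [h1]
    refine ⟨h, hlow _ ?_, hup c hc⟩
    exact Nat.lt_ceil.mp (by omega)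

/-- The same for the first coordinate, where `[0, 0]` has index `0`. -/
noncomputable def locate₀ (lnδ L x : ℝ) : Timed ℕ := do
  let z ← le x 0
  if z then pure 0 else locate lnδ L x

def newTable (G : Grid) : Timed Table := ⟨fun _ _ _ => none, (G.m₁ + 1) * G.m₂ * G.m₃⟩

def readCell (T : Table) (i₁ i₂ i₃ : ℕ) : Timed (Option Quad) := ⟨T i₁ i₂ i₃, 1⟩

def writeCell (T : Table) (i₁ i₂ i₃ : ℕ) (e : Quad) : Timed Table :=
  ⟨Function.update T i₁ (Function.update (T i₁) i₂ (Function.update (T i₁ i₂) i₃ (some e))), 1⟩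

/-- Save a quadruple in its box; if the box is occupied, keep the one with smaller `ℓ₁`. -/
noncomputable def save (G : Grid) (T : Table) (e : Quad) : Timed Table := do
  let i₁ ← locate₀ G.lnδ G.L₁ e.ℓ₁
  let i₂ ← locate G.lnδ G.L₂ e.ℓ₂
  let i₃ ← locate G.lnδ G.L₃ e.Z
  let c ← readCell T i₁ i₂ i₃
  match c with
  | none => writeCell T i₁ i₂ i₃ e
  | some old => do
    let better ← lt e.ℓ₁ old.ℓ₁
    if better then writeCell T i₁ i₂ i₃ e else pure T

/-- Scan all boxes of a table, running `f` on each saved quadruple. -/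
def scan {σ : Type} (G : Grid) (T : Table) (f : Quad → σ → Timed σ) (s : σ) : Timed σ :=
  loop 0 (G.m₁ + 1) (fun i₁ s =>
    loop 1 G.m₂ (fun i₂ s =>
      loop 1 G.m₃ (fun i₃ s => do
        let c ← readCell T i₁ i₂ i₃
        match c with
        | none => pure s
        | some e => f e s) s) s) s

/-- Put the jobs `J_{last+1}, …, J_n` at the end of the later schedule, from time `ℓ₂` on: their
last completion time and their total weighted completion time. -/
noncomputable def appendLast (X : Ctx) (ℓ₂ : ℝ) : Timed (ℝ × ℝ) := do
  let Pn ← read X.pre.P X.n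
  let Pm ← read X.pre.P X.last
  let Wn ← read X.pre.W X.n
  let Wm ← read X.pre.W X.last
  let Zn ← read X.pre.Z X.n
  let Zm ← read X.pre.Z X.last
  let dP ← sub Pn Pm
  let dW ← sub Wn Wm
  let dZ ← sub Zn Zm
  let ℓ ← add ℓ₂ dP
  let shift ← sub ℓ₂ Pm
  let s ← mul dW shift
  let z ← add dZ s
  pure (ℓ, z)

/-- Case 1: the next job `J_j` is added to the later schedule. -/
noncomputable def case₁ (X : Ctx) (j : ℕ) (pj wj : ℝ) (e : Quad) (next : Table) :
    Timed Table := do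
  let c ← add e.ℓ₂ pj
  let z ← mul wj c
  let Z ← add e.Z z
  let l ← cons c e.comp
  save X.grid next { j := j, ℓ₁ := e.ℓ₁, ℓ₂ := c, Z := Z, comp := l }

/-- Case 2: `J_j` is added to the earlier schedule without idling, to complete at time `c`. -/
noncomputable def case₂ (X : Ctx) (j : ℕ) (wj c : ℝ) (e : Quad) (next : Table) :
    Timed Table := do
  let z ← mul wj c
  let Z ← add e.Z z
  let l ← cons c e.comp
  save X.grid next { j := j, ℓ₁ := c, ℓ₂ := e.ℓ₂, Z := Z, comp := l }

/-- Case 3: the machine idles so that `J_{j+1}, …, J_{j₃}`, processed contiguously in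
the earlier schedule (`j` is the index of the quadruple), complete exactly `k` units earlier than
in `π*`; all other jobs go to the later schedule. -/
noncomputable def case₃ (X : Ctx) (e : Quad) (full : Table) : Timed Table := do
  let Pm ← read X.pre.P X.last
  let ℓ ← sub Pm X.k
  let Zm ← read X.pre.Z X.last
  let Zj ← read X.pre.Z e.j
  let Wm ← read X.pre.W X.last
  let Wj ← read X.pre.W e.j
  let dZ ← sub Zm Zj
  let dW ← sub Wm Wj
  let kW ← mul X.k dW
  let z ← sub dZ kW
  let Z ← add e.Z z
  let t ← appendLast X e.ℓ₂
  let Z' ← add Z t.2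
  save X.grid full { j := e.j, ℓ₁ := ℓ, ℓ₂ := t.1, Z := Z', comp := e.comp }

/-- Assign the next job to the partial schedule `e`. The state consists of the table of the next
level and the table of the full schedules. -/
noncomputable def extend (X : Ctx) (e : Quad) (s : Table × Table) : Timed (Table × Table) := do
  let j ← addN e.j 1
  let pj ← read X.p j
  let wj ← read X.w j
  let next ← case₁ X j pj wj e s.1
  let c ← add e.ℓ₁ pj
  let Cj ← read X.pre.P j
  let r ← sub Cj X.k
  let fits ← le c X.T₁
  let close ← le r c
  let idle ← lt c r
  let room ← le r X.T₁
  let next ← if fits && close then case₂ X j wj c e next else pure next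
  let full ← if idle && room then case₃ X e s.2 else pure s.2
  pure (next, full)

/-- Complete a partial schedule on the jobs `J_1, …, J_last`. -/
noncomputable def complete (X : Ctx) (e : Quad) (full : Table) : Timed Table := do
  let t ← appendLast X e.ℓ₂
  let Z ← add e.Z t.2
  save X.grid full { j := e.j, ℓ₁ := e.ℓ₁, ℓ₂ := t.1, Z := Z, comp := e.comp }

/-- The quadruple of smallest `Z`. -/
noncomputable def selectMin (e : Quad) (best : Option Quad) : Timed (Option Quad) := do
  match best with
  | none => pure (some e)
  | some b => do
    let better ← lt e.Z b.Z
    if better then pure (some e) else pure (some b)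

/-- Write the completion times `J_j, J_{j-1}, …` found in the list. -/
def unwind : List ℝ → ℕ → (ℕ → ℝ) → Timed (ℕ → ℝ)
  | [], _, C => pure C
  | c :: l, j, C => do
    let C ← write C j c
    let j ← subN j 1
    unwind l j C

/-- Recover the starting times of the full schedule described by a quadruple. -/
noncomputable def backtrack (X : Ctx) (a : ℕ) (e : Quad) : Timed (ℕ → ℝ) := do
  let size ← addN X.n 1
  let C ← newArray size
  let m ← subN a 1
  let C ← loop 1 m (fun i C => do
    let x ← read X.pre.P i
    write C i x) C
  let C ← unwind e.comp e.j C
  let lo ← addN e.j 1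
  let m ← subN X.last e.j
  let C ← loop lo m (fun i C => do
    let x ← read X.pre.P i
    let y ← sub x X.k
    write C i y) C
  let Pn ← read X.pre.P X.n
  let shift ← sub e.ℓ₂ Pn
  let lo ← addN X.last 1
  let m ← subN X.n X.last
  let C ← loop lo m (fun i C => do
    let x ← read X.pre.P i
    let y ← add shift x
    write C i y) C
  let S ← newArray size
  loop 1 X.n (fun i S => do
    let c ← read C i
    let x ← read X.p i
    let y ← sub c x
    write S i y) S

/-- What the algorithm returns: a total weighted completion time and the starting times of a
schedule. -/
structure Output where
  value : ℝ
  schedule : ℕ → ℝ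

/-- Algorithm `Approx(a, ε)` on an instance (`none` if no full schedule is found). -/
noncomputable def approx (I : Inst) (a : ℕ) (ε : ℝ) : Timed (Option Output) := do
  let n := I.n
  let p : ℕ → ℝ := fun j => I.p j
  let w : ℕ → ℝ := fun j => I.w j
  let T₁ : ℝ := I.T₁
  let T₂ : ℝ := I.T₂
  let k : ℝ := I.k
  let pre ← prepare n p w T₁ k
  -- Step 1: the subdivision into boxes
  let twoN ← mul 2 n
  let q ← div ε twoN
  let δ ← add 1 q
  let lnδ ← ln δ
  let pa ← read p a
  let wa ← read w a
  let b ← subN a 1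
  let Pb ← read pre.P b
  let Zb ← read pre.Z b
  let L₂ ← add T₂ pa
  let z ← mul wa L₂
  let L₃ ← add Zb z
  let Pn ← read pre.P n
  let Wn ← read pre.W n
  let Zn ← read pre.Z n
  let U₂ ← add T₂ Pn
  let u ← mul Wn T₂
  let U₃ ← add Zn u
  let m₁ ← pieces lnδ pre.pMin T₁
  let m₂ ← pieces lnδ L₂ U₂
  let m₃ ← pieces lnδ L₃ U₃
  let last ← maxN a pre.j₃
  let G : Grid :=
    { lnδ := lnδ, L₁ := pre.pMin, L₂ := L₂, L₃ := L₃, m₁ := m₁, m₂ := m₂, m₃ := m₃ }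
  let X : Ctx :=
    { p := p, w := w, T₁ := T₁, T₂ := T₂, k := k, n := n, last := last, pre := pre, grid := G }
  -- Step 2: the trimmed dynamic program, level by level
  let cur ← newTable G
  let full ← newTable G
  let l ← cons L₂ []
  let cur ← save G cur { j := a, ℓ₁ := Pb, ℓ₂ := L₂, Z := L₃, comp := l }
  let levels ← subN last a
  let s ← loop a levels (fun _ s => do
    let next ← newTable G
    scan G s.1 (extend X) (next, s.2)) (cur, full)
  let full ← scan G s.1 (complete X) s.2
  -- Step 3: the best full schedule
  let best ← scan G full selectMin none
  match best with
  | none => pure none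
  | some e => do
    let S ← backtrack X a e
    pure (some { value := e.Z, schedule := S })

end Algorithm

end Resched

/-! A partial schedule of $J_1,\dots,J_j$ without idle time is determined by its set `E` of early
jobs; its quadruple is `early E j`, `late E j`, `partialCost E j`. Every saved quadruple comes from
such a set (`Partial`, `Full`), so what is returned is feasible (`Full.feasible`) and its value is
exact. Something is always returned, since keeping $J_1,\dots,J_{a-1}$ in place and moving all other
jobs behind $T_2$ is feasible.

For the ratio, fix a feasible constrained schedule `S`. The lower bound is `fullCost_le_cost`: for
each `j ≤ m`, the cost of `S` is at least the sum in which $J_1,\dots,J_j$ stay on the sides chosen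
by `S`, packed without idle time (Smith's rule), each of $J_{j+1},\dots,J_m$ is charged only its
earliest permitted completion time $C_i(\pi^*)-k$, and the remaining jobs, which are too late to be
early in `S`, come last.

By induction over the levels (`Progress`), either some stored quadruple has $\ell^1$ at most that of
`S`, and $\ell^2$ and $Z$ at most $\delta^d$ times those of `S`, or the full schedules already
account for one of cost at most $\delta^d$ times that of `S`. The step is `extend_covers`. If
$J_{j+1}$ is late in `S`, case 1 imitates this. If it is early, the smaller $\ell^1$ makes it fit
before $T_1$. Then either it does not complete too early and case 2 imitates `S`, or case 3 produces
a full schedule, and the lower bound says that it is cheap enough. So a smaller $\ell^1$ never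
hurts, which is why each box keeps the smallest one: storing loses a factor $\delta$ in $\ell^2$ and
$Z$ and nothing in $\ell^1$. This loss occurs at most $n$ times, and $(1+\epsilon/2n)^n\le
e^{\epsilon/2}\le 1+\epsilon$.

For the time, each of at most $n$ levels scans its boxes with constant work per box. As
$\log\delta\ge\epsilon/4n$, each coordinate has $O(n/\epsilon)$ times a logarithm many pieces. -/

namespace Resched

/-! ### Values and running times of loops -/

namespace Timed

@[simp] theorem val_bind {α β : Type} (x : Timed α) (f : α → Timed β) :
    (x >>= f).val = (f x.val).val := rfl

@[simp] theorem time_bind {α β : Type} (x : Timed α) (f : α → Timed β) :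
    (x >>= f).time = x.time + (f x.val).time := rfl

@[simp] theorem val_pure {α : Type} (x : α) : (pure x : Timed α).val = x := rfl

@[simp] theorem time_pure {α : Type} (x : α) : (pure x : Timed α).time = 0 := rfl

theorem loop_succ {σ : Type} (lo m : ℕ) (body : ℕ → σ → Timed σ) (s : σ) :
    (loop lo (m + 1) body s).val = (body (lo + m) (loop lo m body s).val).val := rfl

theorem loop_induction {σ : Type} {lo m : ℕ} {body : ℕ → σ → Timed σ} {s : σ}
    (Inv : ℕ → σ → Prop) (h0 : Inv 0 s)
    (hstep : ∀ i s, i < m → Inv i s → Inv (i + 1) (body (lo + i) s).val) :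
    Inv m (loop lo m body s).val := by
  induction m with
  | zero => exact h0
  | succ m ih =>
    rw [loop_succ]
    exact hstep m _ (Nat.lt_succ_self m) (ih fun i s hi => hstep i s (hi.trans (Nat.lt_succ_self m)))

theorem loop_invariant {σ : Type} {lo m : ℕ} {body : ℕ → σ → Timed σ} {s : σ}
    (Inv : σ → Prop) (h0 : Inv s)
    (hstep : ∀ i s, lo ≤ i → i < lo + m → Inv s → Inv (body i s).val) :
    Inv (loop lo m body s).val :=
  loop_induction (fun _ => Inv) h0 fun i s hi => hstep (lo + i) s (by omega) (by omega)

/-- Iteration `j` creates `Q` out of `Inv` alone, and every later iteration keeps it. It serves to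
show that one particular stored quadruple leaves its trace in the result of a scan. -/
theorem loop_reach {σ : Type} {lo m : ℕ} {body : ℕ → σ → Timed σ} {s : σ}
    (Inv Q : σ → Prop) (h0 : Inv s)
    (hInv : ∀ i s, lo ≤ i → i < lo + m → Inv s → Inv (body i s).val)
    (hQ : ∀ i s, lo ≤ i → i < lo + m → Inv s → Q s → Q (body i s).val)
    {j : ℕ} (hj : lo ≤ j) (hj' : j < lo + m) (hjQ : ∀ s, Inv s → Q (body j s).val) :
    Q (loop lo m body s).val := by
  have key := loop_induction (lo := lo) (m := m) (body := body) (s := s)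
    -- `Q` is claimed only once iteration `j` has been executed.
    (fun i s => Inv s ∧ (j < lo + i → Q s)) ⟨h0, fun h => absurd h (by omega)⟩
    (fun i s hi hs => by
      refine ⟨hInv _ _ (by omega) (by omega) hs.1, fun hlt => ?_⟩
      by_cases h : j < lo + i
      · exact hQ _ _ (by omega) (by omega) hs.1 (hs.2 h)
      · obtain rfl : j = lo + i := by omega
        exact hjQ s hs.1)
  exact key.2 hj'

theorem loop_time_le {σ : Type} {lo m c : ℕ} {body : ℕ → σ → Timed σ} {s : σ}
    (h : ∀ i s, (body i s).time ≤ c) : (loop lo m body s).time ≤ m * (c + 1) := by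
  induction m with
  | zero => exact le_of_eq (by simp [loop])
  | succ m ih =>
    have e : (loop lo (m + 1) body s).time = (loop lo m body s).time +
      (1 + (body (lo + m) (loop lo m body s).val).time) := rfl
    rw [e, Nat.succ_mul]
    have := h (lo + m) (loop lo m body s).val
    omega

end Timed

open Timed

/-! ### Boxes -/

/-- The endpoints of a piece have ratio `δ`; the piece with index `0` is empty. -/
theorem le_mul_of_mem_piece {δ L x y : ℝ} {i : ℕ} (hδ : 1 < δ) (hx : x ∈ piece δ L i)
    (hy : y ∈ piece δ L i) : y ≤ δ * x := by
  rcases hx with ⟨hi, hx, -⟩ | ⟨hi, hx, -⟩ <;> rcases hy with ⟨hi', -, hy⟩ | ⟨hi', -, hy⟩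
  · nlinarith
  · omega
  · omega
  · have : L * δ ^ i = δ * (L * δ ^ (i - 1)) := by
      obtain ⟨m, rfl⟩ : ∃ m, i = m + 1 := ⟨i - 1, by omega⟩
      rw [Nat.add_sub_cancel, pow_succ]; ring
    rw [this] at hy
    nlinarith

theorem le_mul_of_locate_eq {δ L x y : ℝ} (hδ : 1 < δ) (hL : 0 < L) (hx : L ≤ x) (hy : L ≤ y)
    (h : (locate (Real.log δ) L y).val = (locate (Real.log δ) L x).val) : y ≤ δ * x :=
  le_mul_of_mem_piece hδ (mem_piece_locate hδ hL hx) (h ▸ mem_piece_locate hδ hL hy)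

theorem one_le_locate (lnδ L x : ℝ) : 1 ≤ (locate lnδ L x).val := le_max_left _ _

/-- No point of `[L, U]` lies beyond the scanned boxes, because `⌈s⌉ ≤ ⌊t⌋ + 1` whenever `s ≤ t`. -/
theorem locate_le_pieces {lnδ L U x : ℝ} (hδ : 0 < lnδ) (hL : 0 < L) (hx : L ≤ x) (hU : x ≤ U) :
    (locate lnδ L x).val ≤ (pieces lnδ L U).val := by
  have h1 : (locate lnδ L x).val = max 1 ⌈Real.log (x / L) / lnδ⌉₊ := rfl
  have h2 : (pieces lnδ L U).val = ⌊Real.log (U / L) / lnδ⌋₊ + 1 := rfl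
  rw [h1, h2]
  refine max_le (by omega) (Nat.ceil_le.2 ?_)
  have h3 : Real.log (x / L) / lnδ ≤ Real.log (U / L) / lnδ := by
    gcongr
    exact div_pos (hL.trans_le hx) hL
  push_cast
  exact h3.trans (Nat.lt_floor_add_one _).le

noncomputable def Grid.cell₁ (G : Grid) (e : Quad) : ℕ := (locate₀ G.lnδ G.L₁ e.ℓ₁).val
noncomputable def Grid.cell₂ (G : Grid) (e : Quad) : ℕ := (locate G.lnδ G.L₂ e.ℓ₂).val
noncomputable def Grid.cell₃ (G : Grid) (e : Quad) : ℕ := (locate G.lnδ G.L₃ e.Z).val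

/-- The quadruple lies in the part of the box grid that is scanned. -/
structure Grid.Fits (G : Grid) (e : Quad) : Prop where
  le₁ : G.cell₁ e ≤ G.m₁
  le₂ : G.cell₂ e ≤ G.m₂
  le₃ : G.cell₃ e ≤ G.m₃

/-- Each quadruple of the table lies in its own box and has the property `good`. -/
def Sound (G : Grid) (good : Quad → Prop) (T : Table) : Prop :=
  ∀ i₁ i₂ i₃ e, T i₁ i₂ i₃ = some e →
    good e ∧ i₁ = G.cell₁ e ∧ i₂ = G.cell₂ e ∧ i₃ = G.cell₃ e

/-- The box of `e` holds a quadruple at least as good as `e` in the first coordinate. -/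
def Covers (G : Grid) (T : Table) (e : Quad) : Prop :=
  ∃ e', T (G.cell₁ e) (G.cell₂ e) (G.cell₃ e) = some e' ∧ e'.ℓ₁ ≤ e.ℓ₁

/-- `e` is found when the table is scanned. -/
def Stored (G : Grid) (T : Table) (e : Quad) : Prop :=
  ∃ i₁ i₂ i₃, i₁ ≤ G.m₁ ∧ 1 ≤ i₂ ∧ i₂ ≤ G.m₂ ∧ 1 ≤ i₃ ∧ i₃ ≤ G.m₃ ∧ T i₁ i₂ i₃ = some e

theorem save_val (G : Grid) (T : Table) (e : Quad) :
    (save G T e).val = match T (G.cell₁ e) (G.cell₂ e) (G.cell₃ e) with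
      | none => (writeCell T (G.cell₁ e) (G.cell₂ e) (G.cell₃ e) e).val
      | some old => if e.ℓ₁ < old.ℓ₁ then
          (writeCell T (G.cell₁ e) (G.cell₂ e) (G.cell₃ e) e).val else T := by
  change Timed.val (match T (G.cell₁ e) (G.cell₂ e) (G.cell₃ e) with
    | none => _ | some old => _) = _
  split
  · rfl
  · change Timed.val (if decide _ = true then _ else _) = _
    simp only [decide_eq_true_eq]
    split <;> rfl

theorem writeCell_apply (T : Table) (i₁ i₂ i₃ : ℕ) (e : Quad) (k₁ k₂ k₃ : ℕ) :
    (writeCell T i₁ i₂ i₃ e).val k₁ k₂ k₃ =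
      if k₁ = i₁ ∧ k₂ = i₂ ∧ k₃ = i₃ then some e else T k₁ k₂ k₃ := by
  simp only [writeCell, Function.update_apply]
  by_cases h₁ : k₁ = i₁ <;> by_cases h₂ : k₂ = i₂ <;> by_cases h₃ : k₃ = i₃ <;>
    simp [h₁, h₂, h₃]

theorem Sound.save {G : Grid} {good : Quad → Prop} {T : Table} {e : Quad} (hT : Sound G good T)
    (he : good e) : Sound G good (save G T e).val := by
  have hw : Sound G good (writeCell T (G.cell₁ e) (G.cell₂ e) (G.cell₃ e) e).val := by
    intro i₁ i₂ i₃ e' h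
    rw [writeCell_apply] at h
    split at h
    · obtain rfl : e = e' := by simpa using h
      tauto
    · exact hT _ _ _ _ h
  rw [save_val]
  split
  · exact hw
  · split
    · exact hw
    · exact hT

theorem covers_save_self (G : Grid) (T : Table) (e : Quad) : Covers G (save G T e).val e := by
  have hw : Covers G (writeCell T (G.cell₁ e) (G.cell₂ e) (G.cell₃ e) e).val e :=
    ⟨e, by rw [writeCell_apply]; simp, le_rfl⟩
  rw [save_val]
  split
  · exact hw
  · rename_i old h
    split
    · exact hw
    · exact ⟨old, h, by linarith⟩

/-- An occupant is replaced only by one with strictly smaller first coordinate, and saving in a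
different box does not touch this one. -/
theorem Covers.save {G : Grid} {T : Table} {e₀ : Quad} (h : Covers G T e₀) (e : Quad) :
    Covers G (save G T e).val e₀ := by
  obtain ⟨e', he', hle⟩ := h
  by_cases hc : G.cell₁ e₀ = G.cell₁ e ∧ G.cell₂ e₀ = G.cell₂ e ∧ G.cell₃ e₀ = G.cell₃ e
  · obtain ⟨e'', h₁, h₂⟩ := covers_save_self G T e
    rw [hc.1, hc.2.1, hc.2.2] at he'
    refine ⟨e'', by rw [hc.1, hc.2.1, hc.2.2]; exact h₁, ?_⟩
    rw [save_val, he'] at h₁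
    simp only at h₁
    split at h₁
    · rw [writeCell_apply] at h₁
      simp at h₁
      subst h₁
      linarith
    · rw [he'] at h₁
      simp at h₁
      subst h₁
      exact hle
  · have hw : (writeCell T (G.cell₁ e) (G.cell₂ e) (G.cell₃ e) e).val
        (G.cell₁ e₀) (G.cell₂ e₀) (G.cell₃ e₀) = some e' := by
      rw [writeCell_apply, if_neg hc, he']
    rw [save_val]
    split
    · exact ⟨e', hw, hle⟩
    · split
      · exact ⟨e', hw, hle⟩
      · exact ⟨e', he', hle⟩

theorem sound_empty (G : Grid) (good : Quad → Prop) : Sound G good (newTable G).val := by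
  intro i₁ i₂ i₃ e h
  simp [newTable] at h

theorem Stored.good {G : Grid} {good : Quad → Prop} {T : Table} {e : Quad} (hT : Sound G good T)
    (h : Stored G T e) : good e := by
  obtain ⟨i₁, i₂, i₃, -, -, -, -, -, h⟩ := h
  exact (hT _ _ _ _ h).1

/-- A covered quadruple that fits the grid is represented by a stored one in the same box. -/
theorem Covers.exists_stored {G : Grid} {good : Quad → Prop} {T : Table} {e : Quad}
    (hT : Sound G good T) (hf : G.Fits e) (h : Covers G T e) :
    ∃ e', Stored G T e' ∧ good e' ∧ e'.ℓ₁ ≤ e.ℓ₁ ∧ G.cell₂ e' = G.cell₂ e ∧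
      G.cell₃ e' = G.cell₃ e := by
  obtain ⟨e', he', hle⟩ := h
  obtain ⟨h0, h1, h2, h3⟩ := hT _ _ _ _ he'
  exact ⟨e', ⟨_, _, _, hf.le₁, one_le_locate _ _ _, hf.le₂, one_le_locate _ _ _, hf.le₃, he'⟩,
    h0, hle, h2.symm, h3.symm⟩

/-! ### Scanning a table -/

theorem scan_invariant {σ : Type} {G : Grid} {T : Table} {f : Quad → σ → Timed σ} {s : σ}
    (Inv : σ → Prop) (h0 : Inv s) (hf : ∀ e s, Stored G T e → Inv s → Inv (f e s).val) :
    Inv (scan G T f s).val := by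
  refine loop_invariant Inv h0 fun i₁ s _ hi₁ hs => ?_
  refine loop_invariant Inv hs fun i₂ s hi₂ hi₂' hs => ?_
  refine loop_invariant Inv hs fun i₃ s hi₃ hi₃' hs => ?_
  change Inv (Timed.val (match T i₁ i₂ i₃ with | none => _ | some e => _))
  split
  · exact hs
  · rename_i e he
    exact hf e s ⟨i₁, i₂, i₃, by omega, by omega, by omega, by omega, by omega, he⟩ hs

/-- `loop_reach` is applied once per coordinate, at the coordinates of the box that holds `e`. -/
theorem scan_reach {σ : Type} {G : Grid} {T : Table} {f : Quad → σ → Timed σ} {s : σ}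
    (Inv Q : σ → Prop) (h0 : Inv s) (hInv : ∀ e s, Stored G T e → Inv s → Inv (f e s).val)
    (hQ : ∀ e s, Stored G T e → Inv s → Q s → Q (f e s).val)
    {e : Quad} (he : Stored G T e) (heQ : ∀ s, Inv s → Q (f e s).val) :
    Q (scan G T f s).val := by
  have body : ∀ (R : σ → Prop), (∀ e s, Stored G T e → R s → R (f e s).val) →
      ∀ i₁ i₂ i₃ s, i₁ < 0 + (G.m₁ + 1) → 1 ≤ i₂ → i₂ < 1 + G.m₂ → 1 ≤ i₃ → i₃ < 1 + G.m₃ → R s →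
        R (readCell T i₁ i₂ i₃ >>= fun c => match c with
          | none => pure s
          | some e => f e s).val := by
    intro R hR i₁ i₂ i₃ s h₁ h₂ h₂' h₃ h₃' hs
    change R (Timed.val (match T i₁ i₂ i₃ with | none => _ | some e => _))
    split
    · exact hs
    · rename_i e he
      exact hR e s ⟨i₁, i₂, i₃, by omega, by omega, by omega, by omega, by omega, he⟩ hs
  have hIQ : ∀ e s, Stored G T e → (Inv s ∧ Q s) → Inv (f e s).val ∧ Q (f e s).val :=
    fun e s he hs => ⟨hInv e s he hs.1, hQ e s he hs.1 hs.2⟩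
  have bodyI := body Inv hInv
  have bodyQ := body (fun s => Inv s ∧ Q s) hIQ
  obtain ⟨j₁, j₂, j₃, h₁, h₂, h₂', h₃, h₃', he⟩ := he
  refine loop_reach Inv Q h0 (fun i₁ s _ hi₁ hs => loop_invariant Inv hs fun i₂ s hi₂ hi₂' hs =>
      loop_invariant Inv hs fun i₃ s hi₃ hi₃' hs => bodyI _ _ _ _ hi₁ hi₂ hi₂' hi₃ hi₃' hs)
    (fun i₁ s _ hi₁ hs hq => (loop_invariant (fun s => Inv s ∧ Q s) ⟨hs, hq⟩
      fun i₂ s hi₂ hi₂' hs => loop_invariant (fun s => Inv s ∧ Q s) hs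
        fun i₃ s hi₃ hi₃' hs => bodyQ _ _ _ _ hi₁ hi₂ hi₂' hi₃ hi₃' hs).2)
    (j := j₁) (by omega) (by omega) fun s hs => ?_
  refine loop_reach Inv Q hs (fun i₂ s hi₂ hi₂' hs =>
      loop_invariant Inv hs fun i₃ s hi₃ hi₃' hs =>
        bodyI _ _ _ _ (by omega) hi₂ hi₂' hi₃ hi₃' hs)
    (fun i₂ s hi₂ hi₂' hs hq => (loop_invariant (fun s => Inv s ∧ Q s) ⟨hs, hq⟩
        fun i₃ s hi₃ hi₃' hs => bodyQ _ _ _ _ (by omega) hi₂ hi₂' hi₃ hi₃' hs).2)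
    (j := j₂) (by omega) (by omega) fun s hs => ?_
  refine loop_reach Inv Q hs (fun i₃ s hi₃ hi₃' hs =>
        bodyI _ _ _ _ (by omega) (by omega) (by omega) hi₃ hi₃' hs)
    (fun i₃ s hi₃ hi₃' hs hq =>
      (bodyQ _ _ _ _ (by omega) (by omega) (by omega) hi₃ hi₃' ⟨hs, hq⟩).2)
    (j := j₃) (by omega) (by omega) fun s hs => ?_
  change Q (Timed.val (match T j₁ j₂ j₃ with | none => _ | some e => _))
  rw [he]
  exact heQ s hs

/-! ### Running times -/

theorem locate_time (lnδ L x : ℝ) : (locate lnδ L x).time = 5 := rfl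

theorem locate₀_time_le (lnδ L x : ℝ) : (locate₀ lnδ L x).time ≤ 6 := by
  change 1 + Timed.time (if decide (x ≤ 0) = true then _ else _) ≤ 6
  split
  · simp
  · simp [locate_time]

theorem save_time_le (G : Grid) (T : Table) (e : Quad) : (save G T e).time ≤ 19 := by
  change (locate₀ G.lnδ G.L₁ e.ℓ₁).time + (5 + (5 + (1 + Timed.time
    (match T (G.cell₁ e) (G.cell₂ e) (G.cell₃ e) with | none => _ | some old => _)))) ≤ 19
  have := locate₀_time_le G.lnδ G.L₁ e.ℓ₁
  split
  · simp [writeCell]; omega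
  · rename_i old _
    change _ + (5 + (5 + (1 + (1 + Timed.time (if decide (e.ℓ₁ < old.ℓ₁) = true then _ else _)))))
      ≤ 19
    split
    · simp [writeCell]; omega
    · simp; omega

theorem scan_time_le {σ : Type} {G : Grid} {T : Table} {f : Quad → σ → Timed σ} {s : σ} {c : ℕ}
    (h₂ : 1 ≤ G.m₂) (h₃ : 1 ≤ G.m₃) (hf : ∀ e s, (f e s).time ≤ c) :
    (scan G T f s).time ≤ (c + 4) * ((G.m₁ + 1) * G.m₂ * G.m₃) := by
  have h := loop_time_le (lo := 0) (m := G.m₁ + 1) (c := G.m₂ * (G.m₃ * ((1 + c) + 1) + 1)) (s := s)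
    (body := fun i₁ s =>
    loop 1 G.m₂ (fun i₂ s =>
      loop 1 G.m₃ (fun i₃ s => do
        let c ← readCell T i₁ i₂ i₃
        match c with
        | none => pure s
        | some e => f e s) s) s) (fun i₁ s => loop_time_le fun i₂ s => loop_time_le fun i₃ s => by
      change 1 + Timed.time (match T i₁ i₂ i₃ with | none => _ | some e => _) ≤ _
      split
      · simp
      · exact Nat.add_le_add_left (hf _ _) _)
  refine h.trans ?_
  -- Per box there are one read, one tick and `c` steps; the ticks of the two outer loops amount to
  -- at most two further steps per box.
  have h4 : 1 ≤ G.m₂ * G.m₃ := Nat.mul_pos h₂ h₃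
  have h5 : G.m₂ ≤ G.m₂ * G.m₃ := Nat.le_mul_of_pos_right _ h₃
  calc (G.m₁ + 1) * (G.m₂ * (G.m₃ * ((1 + c) + 1) + 1) + 1)
      = (G.m₁ + 1) * ((c + 2) * (G.m₂ * G.m₃) + G.m₂ + 1) := by ring
    _ ≤ (G.m₁ + 1) * ((c + 2) * (G.m₂ * G.m₃) + G.m₂ * G.m₃ + G.m₂ * G.m₃) := by gcongr
    _ = _ := by ring

/-! ### Sums over initial segments -/

theorem sum_Icc_eq_add_sum_Ioc (f : ℕ → ℝ) {j m : ℕ} (h : j ≤ m) :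
    ∑ i ∈ Finset.Icc 1 m, f i = ∑ i ∈ Finset.Icc 1 j, f i + ∑ i ∈ Finset.Ioc j m, f i := by
  have key : ∀ m, Finset.Icc 1 m = Finset.Ioc 0 m := fun m => by ext; simp; omega
  rw [key, key, Finset.sum_Ioc_consecutive f (Nat.zero_le j) h]

/-- Jobs processed one at a time in `[t, T]` have total length at most `T - t`. -/
theorem sum_le_of_disjoint {ι : Type*} [DecidableEq ι] (A : Finset ι) {S p : ι → ℝ} {t : ℝ}
    (hp : ∀ i ∈ A, 0 < p i) (ht : ∀ i ∈ A, t ≤ S i)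
    (hd : ∀ i ∈ A, ∀ j ∈ A, i ≠ j → S i + p i ≤ S j ∨ S j + p j ≤ S i) :
    ∀ T, t ≤ T → (∀ i ∈ A, S i + p i ≤ T) → ∑ i ∈ A, p i ≤ T - t := by
  induction A using Finset.strongInduction with
  | H A ih =>
    intro T htT hT
    rcases A.eq_empty_or_nonempty with rfl | hA
    · simpa using htT
    -- The job `m` that starts last is removed: all others complete by `S m`, so induction applies
    -- with the bound `S m` in place of `T`.
    obtain ⟨m, hm, hmax⟩ := A.exists_max_image S hA
    have h := ih (A.erase m) (Finset.erase_ssubset hm)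
      (fun i hi => hp i (Finset.mem_of_mem_erase hi)) (fun i hi => ht i (Finset.mem_of_mem_erase hi))
      (fun i hi j hj => hd i (Finset.mem_of_mem_erase hi) j (Finset.mem_of_mem_erase hj))
      (S m) (ht m hm) (fun i hi => by
        have hi' := Finset.mem_of_mem_erase hi
        rcases hd i hi' m hm (Finset.ne_of_mem_erase hi) with h | h
        · exact h
        · have := hmax i hi'
          have := hp m hm
          linarith)
    rw [← Finset.add_sum_erase A p hm]
    linarith [hT m hm]

/-- Smith's rule: processing the jobs from time `t` on without idle time, in an order in which
`p i / w i` is nondecreasing, minimizes the total weighted completion time. -/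
theorem smith_rule (A : Finset ℕ) {S p w : ℕ → ℝ} {t : ℝ}
    (hp : ∀ i ∈ A, 0 < p i) (hw : ∀ i ∈ A, 0 < w i) (ht : ∀ i ∈ A, t ≤ S i)
    (hd : ∀ i ∈ A, ∀ j ∈ A, i ≠ j → S i + p i ≤ S j ∨ S j + p j ≤ S i)
    (hs : ∀ i ∈ A, ∀ j ∈ A, i ≤ j → p i * w j ≤ p j * w i) :
    ∑ j ∈ A, w j * (t + ∑ i ∈ A, if i ≤ j then p i else 0) ≤ ∑ j ∈ A, w j * (S j + p j) := by
  -- The jobs starting no later than `j` all complete by `S j + p j`, so their total length fits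
  -- between `t` and this time.
  have hvol : ∀ j ∈ A, t + ∑ i ∈ A, (if S i ≤ S j then p i else 0) ≤ S j + p j := by
    intro j hj
    rw [← Finset.sum_filter]
    have h := sum_le_of_disjoint (A.filter fun i => S i ≤ S j) (S := S) (p := p) (t := t)
      (fun i hi => hp i (Finset.mem_filter.1 hi).1) (fun i hi => ht i (Finset.mem_filter.1 hi).1)
      (fun i hi k hk => hd i (Finset.mem_filter.1 hi).1 k (Finset.mem_filter.1 hk).1)
      (S j + p j) (by linarith [ht j hj, hp j hj]) (fun i hi => by
        obtain ⟨hi, hij⟩ := Finset.mem_filter.1 hi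
        rcases eq_or_ne i j with rfl | hne
        · exact le_rfl
        · rcases hd i hi j hj hne with h | h
          · linarith [hp j hj]
          · linarith [hp j hj])
    linarith
  refine le_trans ?_ (Finset.sum_le_sum fun j hj => mul_le_mul_of_nonneg_left (hvol j hj)
    (hw j hj).le)
  have hne : ∀ i ∈ A, ∀ j ∈ A, i ≠ j → S i ≠ S j := by
    intro i hi j hj hij h
    rcases hd i hi j hj hij with h' | h'
    · linarith [hp i hi]
    · linarith [hp j hj]
  simp only [mul_add, Finset.sum_add_distrib, Finset.mul_sum]
  refine add_le_add le_rfl ?_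
  -- symmetrize both double sums
  have hsym : ∀ F : ℕ → ℕ → ℝ, 2 * ∑ j ∈ A, ∑ i ∈ A, F j i = ∑ j ∈ A, ∑ i ∈ A, (F j i + F i j) := by
    intro F
    simp only [Finset.sum_add_distrib]
    rw [Finset.sum_comm (f := fun x y => F y x), two_mul]
  refine le_of_mul_le_mul_left ?_ (two_pos (α := ℝ))
  rw [hsym, hsym]
  refine Finset.sum_le_sum fun j hj => Finset.sum_le_sum fun i hi => ?_
  -- For a pair of distinct jobs, the one processed first delays the other. The left side charges
  -- the product for the index order, the right side the product for the order of starting times,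
  -- and `hs` says that the former is the smaller of the two.
  rcases lt_trichotomy i j with h | rfl | h
  · have h1 := hs i hi j hj h.le
    have h2 := hne i hi j hj h.ne
    rcases lt_or_gt_of_ne h2 with h3 | h3
    · simp [h.le, h.not_ge, h3.le, h3.not_ge]
    · simp [h.le, h.not_ge, h3.le, h3.not_ge]; linarith
  · simp
  · have h1 := hs j hj i hi h.le
    have h2 := hne j hj i hi h.ne
    rcases lt_or_gt_of_ne h2 with h3 | h3
    · simp [h.le, h.not_ge, h3.le, h3.not_ge]
    · simp [h.le, h.not_ge, h3.le, h3.not_ge]; linarith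

/-! ### Schedules determined by their set of early jobs -/

namespace Inst

/-- The completion time in `π*` as a real number. -/
noncomputable def C (I : Inst) (j : ℕ) : ℝ := ∑ i ∈ Finset.Icc 1 j, (I.p i : ℝ)

/-- Total length of the jobs of `E` among `J_1, …, J_j`. -/
noncomputable def early (I : Inst) (E : Finset ℕ) (j : ℕ) : ℝ :=
  ∑ i ∈ Finset.Icc 1 j, if i ∈ E then (I.p i : ℝ) else 0

/-- Completion time of the jobs among `J_1, …, J_j` outside `E`, processed from `T₂` on. -/
noncomputable def late (I : Inst) (E : Finset ℕ) (j : ℕ) : ℝ :=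
  I.T₂ + ∑ i ∈ Finset.Icc 1 j, if i ∈ E then 0 else (I.p i : ℝ)

/-- Completion time of `J_i` when the jobs of `E` form the earlier schedule, without idle time. -/
noncomputable def compl (I : Inst) (E : Finset ℕ) (i : ℕ) : ℝ :=
  if i ∈ E then I.early E i else I.late E i

noncomputable def partialCost (I : Inst) (E : Finset ℕ) (j : ℕ) : ℝ :=
  ∑ i ∈ Finset.Icc 1 j, (I.w i : ℝ) * I.compl E i

/-- Completion times of the full schedule in which `J_1, …, J_j` are assigned according to `E`, the
jobs `J_{j+1}, …, J_m` complete `k` units earlier than in `π*`, and the others come last. -/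
noncomputable def fullC (I : Inst) (E : Finset ℕ) (j m i : ℕ) : ℝ :=
  if i ≤ j then I.compl E i else if i ≤ m then I.C i - I.k else I.late E j + (I.C i - I.C m)

noncomputable def fullCost (I : Inst) (E : Finset ℕ) (j m : ℕ) : ℝ :=
  ∑ i ∈ Finset.Icc 1 I.n, (I.w i : ℝ) * I.fullC E j m i

variable {I : Inst} {E : Finset ℕ} {a i j m : ℕ}

theorem C_eq (I : Inst) (j : ℕ) : I.C j = (I.origC j : ℝ) := by
  simp [C, origC]

theorem C_n (I : Inst) : I.C I.n = (I.P : ℝ) := by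
  simp [C, P]

@[simp] theorem C_zero (I : Inst) : I.C 0 = 0 := by simp [C]

theorem C_succ (I : Inst) (j : ℕ) : I.C (j + 1) = I.C j + I.p (j + 1) := by
  simp [C, Finset.sum_Icc_succ_top]

@[simp] theorem early_zero (I : Inst) (E : Finset ℕ) : I.early E 0 = 0 := by simp [early]

@[simp] theorem late_zero (I : Inst) (E : Finset ℕ) : I.late E 0 = I.T₂ := by simp [late]

@[simp] theorem partialCost_zero (I : Inst) (E : Finset ℕ) : I.partialCost E 0 = 0 := by
  simp [partialCost]

theorem early_succ (I : Inst) (E : Finset ℕ) (j : ℕ) :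
    I.early E (j + 1) = I.early E j + if j + 1 ∈ E then (I.p (j + 1) : ℝ) else 0 := by
  rw [early, Finset.sum_Icc_succ_top (by omega), ← early]

theorem late_succ (I : Inst) (E : Finset ℕ) (j : ℕ) :
    I.late E (j + 1) = I.late E j + if j + 1 ∈ E then 0 else (I.p (j + 1) : ℝ) := by
  simp [late, Finset.sum_Icc_succ_top, add_assoc]

theorem partialCost_succ (I : Inst) (E : Finset ℕ) (j : ℕ) :
    I.partialCost E (j + 1) = I.partialCost E j + (I.w (j + 1) : ℝ) * I.compl E (j + 1) := by
  simp [partialCost, Finset.sum_Icc_succ_top]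

theorem C_mono (I : Inst) : Monotone I.C :=
  monotone_nat_of_le_succ fun j => by rw [C_succ]; simp

theorem early_mono (I : Inst) (E : Finset ℕ) : Monotone (I.early E) :=
  monotone_nat_of_le_succ fun j => by rw [early_succ]; split <;> simp

theorem late_mono (I : Inst) (E : Finset ℕ) : Monotone (I.late E) :=
  monotone_nat_of_le_succ fun j => by rw [late_succ]; split <;> simp

theorem C_nonneg (I : Inst) (j : ℕ) : 0 ≤ I.C j := by
  simpa using I.C_mono (Nat.zero_le j)

theorem early_nonneg (I : Inst) (E : Finset ℕ) (j : ℕ) : 0 ≤ I.early E j := by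
  simpa using I.early_mono E (Nat.zero_le j)

theorem T₂_le_late (I : Inst) (E : Finset ℕ) (j : ℕ) : (I.T₂ : ℝ) ≤ I.late E j := by
  simpa using I.late_mono E (Nat.zero_le j)

/-- Early and late lengths add up to `C j`, so bounds on the late side reduce to bounds on the early
side. -/
theorem late_eq (I : Inst) (E : Finset ℕ) (j : ℕ) : I.late E j = I.T₂ + I.C j - I.early E j := by
  induction j with
  | zero => simp
  | succ j ih => rw [late_succ, C_succ, early_succ, ih]; split <;> ring

theorem compl_nonneg (I : Inst) (E : Finset ℕ) (i : ℕ) : 0 ≤ I.compl E i := by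
  unfold compl
  split
  · exact I.early_nonneg E i
  · exact (Nat.cast_nonneg _).trans (I.T₂_le_late E i)

theorem early_le_C (I : Inst) (E : Finset ℕ) (j : ℕ) : I.early E j ≤ I.C j := by
  have := I.T₂_le_late E j
  rw [late_eq] at this
  linarith

theorem compl_le (I : Inst) (E : Finset ℕ) (i : ℕ) : I.compl E i ≤ I.C i + I.T₂ := by
  unfold compl
  split
  · have := I.early_le_C E i
    have : (0 : ℝ) ≤ I.T₂ := Nat.cast_nonneg _
    linarith
  · rw [late_eq]
    linarith [I.early_nonneg E i]

theorem partialCost_mono (I : Inst) (E : Finset ℕ) : Monotone (I.partialCost E) :=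
  monotone_nat_of_le_succ fun j => by
    rw [partialCost_succ]
    exact le_add_of_nonneg_right (mul_nonneg (Nat.cast_nonneg _) (I.compl_nonneg E _))

theorem early_congr {E' : Finset ℕ} (h : ∀ i, 1 ≤ i → i ≤ j → (i ∈ E ↔ i ∈ E')) :
    I.early E j = I.early E' j := by
  refine Finset.sum_congr rfl fun i hi => ?_
  obtain ⟨h1, h2⟩ := Finset.mem_Icc.1 hi
  simp [h i h1 h2]

theorem late_congr {E' : Finset ℕ} (h : ∀ i, 1 ≤ i → i ≤ j → (i ∈ E ↔ i ∈ E')) :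
    I.late E j = I.late E' j := by
  rw [late_eq, late_eq, early_congr h]

theorem compl_congr {E' : Finset ℕ} (hi : 1 ≤ i) (h : ∀ i', 1 ≤ i' → i' ≤ i → (i' ∈ E ↔ i' ∈ E')) :
    I.compl E i = I.compl E' i := by
  simp only [compl, early_congr h, late_congr h, h i hi le_rfl]

theorem partialCost_congr {E' : Finset ℕ} (h : ∀ i, 1 ≤ i → i ≤ j → (i ∈ E ↔ i ∈ E')) :
    I.partialCost E j = I.partialCost E' j := by
  refine Finset.sum_congr rfl fun i hi => ?_
  obtain ⟨h1, h2⟩ := Finset.mem_Icc.1 hi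
  rw [compl_congr h1 fun i' h1' h2' => h i' h1' (h2'.trans h2)]

theorem early_eq_C (h : ∀ i, 1 ≤ i → i ≤ j → i ∈ E) : I.early E j = I.C j :=
  Finset.sum_congr rfl fun i hi => by
    obtain ⟨h1, h2⟩ := Finset.mem_Icc.1 hi
    simp [h i h1 h2]

theorem fullCost_eq (I : Inst) (E : Finset ℕ) (hj : j ≤ m) (hm : m ≤ I.n) :
    I.fullCost E j m = I.partialCost E j + ∑ i ∈ Finset.Ioc j m, (I.w i : ℝ) * (I.C i - I.k) +
      ∑ i ∈ Finset.Ioc m I.n, (I.w i : ℝ) * (I.late E j + (I.C i - I.C m)) := by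
  rw [fullCost, sum_Icc_eq_add_sum_Ioc _ hm, sum_Icc_eq_add_sum_Ioc _ hj, partialCost]
  congr 1
  · congr 1
    · refine Finset.sum_congr rfl fun i hi => ?_
      rw [fullC, if_pos (Finset.mem_Icc.1 hi).2]
    · refine Finset.sum_congr rfl fun i hi => ?_
      rw [fullC, if_neg (by have := Finset.mem_Ioc.1 hi; omega), if_pos (Finset.mem_Ioc.1 hi).2]
  · refine Finset.sum_congr rfl fun i hi => ?_
    rw [fullC, if_neg (by have := Finset.mem_Ioc.1 hi; omega),
      if_neg (by have := Finset.mem_Ioc.1 hi; omega)]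

/-- The comparison is made term by term. The summands that do not depend on the early set are
nonnegative, so multiplying them by `D ≥ 1` only helps; `hk` provides this for the jobs that
complete `k` units early. -/
theorem fullCost_le_mul {E' : Finset ℕ} {D : ℝ} (hD : 1 ≤ D) (hj : j ≤ m) (hm : m ≤ I.n)
    (hlate : I.late E' j ≤ D * I.late E j) (hcost : I.partialCost E' j ≤ D * I.partialCost E j)
    (hk : ∀ i, j < i → i ≤ m → 0 ≤ I.C i - I.k) :
    I.fullCost E' j m ≤ D * I.fullCost E j m := by
  rw [fullCost_eq _ _ hj hm, fullCost_eq _ _ hj hm, mul_add, mul_add, Finset.mul_sum,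
    Finset.mul_sum]
  refine add_le_add (add_le_add hcost (Finset.sum_le_sum fun i hi => ?_))
    (Finset.sum_le_sum fun i hi => ?_)
  · obtain ⟨h1, h2⟩ := Finset.mem_Ioc.1 hi
    have := mul_nonneg (Nat.cast_nonneg (α := ℝ) (I.w i)) (hk i h1 h2)
    nlinarith
  · obtain ⟨h1, h2⟩ := Finset.mem_Ioc.1 hi
    rw [mul_left_comm]
    refine mul_le_mul_of_nonneg_left ?_ (Nat.cast_nonneg _)
    nlinarith [I.C_mono h1.le]

/-! ### Candidates, partial schedules and full schedules -/

theorem origS_eq (I : Inst) (a : ℕ) : (I.origS a : ℝ) = I.C (a - 1) := by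
  simp only [origS, C, Nat.cast_sum]
  congr 1

theorem C_le_T₁_of_lt_j₁ (hI : I.Valid) (h : j < I.j₁) : I.C j ≤ I.T₁ := by
  rcases Nat.eq_zero_or_pos j with rfl | hj
  · simp
  have hn : j₁ I ∈ {j : ℕ | 1 ≤ j ∧ j ≤ I.n ∧ I.T₁ < I.origC j} := by
    refine Nat.sInf_mem ⟨I.n, ?_, le_rfl, hI.T₁_lt_P⟩
    obtain ⟨i, h1, h2, -⟩ := hI.pMin_le
    exact h1.trans h2
  have h' := Nat.notMem_of_lt_sInf h
  simp only [Set.mem_ofPred_eq, not_and, not_lt] at h'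
  rw [C_eq]
  exact_mod_cast h' hj (h.le.trans hn.2.1)

theorem j₁_le_n (hI : I.Valid) : I.j₁ ≤ I.n := by
  refine Nat.sInf_le ⟨?_, le_rfl, hI.T₁_lt_P⟩
  obtain ⟨i, h1, h2, -⟩ := hI.pMin_le
  exact h1.trans h2

/-- What is used of a candidate `a`. -/
structure Setup (I : Inst) (a m : ℕ) : Prop where
  valid : I.Valid
  one_le : 1 ≤ a
  le_n : a ≤ I.n
  before : I.C (a - 1) ≤ I.T₁
  shift : (I.T₂ : ℝ) - I.C (a - 1) ≤ I.k
  le_last : a ≤ m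
  last_le : m ≤ I.n
  -- For `m = a` this may fail, since `j₃` may then be smaller than `a`; no block of idled jobs is
  -- formed in that case.
  room : a < m → I.C m - I.k ≤ I.T₁
  beyond : ∀ i, m < i → i ≤ I.n → (I.T₁ : ℝ) < I.C i - I.k

/-- `E` is the set of early jobs of a partial schedule of `J_1, …, J_j`. -/
structure Partial (I : Inst) (a : ℕ) (E : Finset ℕ) (j : ℕ) : Prop where
  sub : E ⊆ Finset.Icc 1 j
  before : ∀ i, 1 ≤ i → i < a → i ∈ E
  notMem : a ∉ E
  le : a ≤ j
  early_le : I.early E j ≤ I.T₁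
  dev : ∀ i ∈ E, I.C i - I.k ≤ I.early E i

/-- `E` and `j` describe a full schedule. -/
structure Full (I : Inst) (a m : ℕ) (E : Finset ℕ) (j : ℕ) : Prop extends I.Partial a E j where
  le_last : j ≤ m
  idle : j < m → I.early E j + I.p (j + 1) < I.C (j + 1) - I.k

/-! ### Extending partial schedules by one job -/

theorem Partial.early_before (h : I.Partial a E j) (i : ℕ) (hi : i < a) : I.early E i = I.C i :=
  early_eq_C fun i' h1 h2 => h.before i' h1 (h2.trans_lt hi)

theorem Partial.start (hS : I.Setup a m) : I.Partial a (Finset.Icc 1 (a - 1)) a := by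
  have ha := hS.one_le
  have h1 : ∀ i < a, I.early (Finset.Icc 1 (a - 1)) i = I.C i := fun i hi =>
    early_eq_C fun i' h1 h2 => Finset.mem_Icc.2 ⟨h1, by omega⟩
  refine ⟨Finset.Icc_subset_Icc_right (by omega), fun i h1 h2 => Finset.mem_Icc.2 ⟨h1, by omega⟩,
    by simp; omega, le_rfl, ?_, fun i hi => ?_⟩
  · obtain ⟨b, rfl⟩ : ∃ b, a = b + 1 := ⟨a - 1, by omega⟩
    rw [early_succ, h1 b (by omega), if_neg (by simp)]
    simpa using hS.before
  · obtain ⟨h2, h3⟩ := Finset.mem_Icc.1 hi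
    rw [h1 i (by omega)]
    simp

theorem Partial.late_a (h : I.Partial a E j) (ha : 1 ≤ a) : I.late E a = I.T₂ + I.p a := by
  obtain ⟨b, rfl⟩ : ∃ b, a = b + 1 := ⟨a - 1, by omega⟩
  rw [late_succ, if_neg h.notMem, late_eq, h.early_before b (by omega)]
  ring

theorem Partial.skip (h : I.Partial a E j) : I.Partial a E (j + 1) := by
  refine ⟨h.sub.trans (Finset.Icc_subset_Icc_right (by omega)), h.before, h.notMem,
    h.le.trans (by omega), ?_, h.dev⟩
  rw [early_succ, if_neg, add_zero]
  · exact h.early_le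
  · intro hj
    have := Finset.mem_Icc.1 (h.sub hj)
    omega

theorem Partial.succ_notMem (h : I.Partial a E j) : j + 1 ∉ E := fun hj => by
  have := Finset.mem_Icc.1 (h.sub hj)
  omega

theorem mem_insert_succ (hi : i ≤ j) : (i ∈ insert (j + 1) E ↔ i ∈ E) := by
  simp only [Finset.mem_insert, or_iff_right_iff_imp]
  omega

theorem early_insert (hi : i ≤ j) : I.early (insert (j + 1) E) i = I.early E i :=
  early_congr fun _ _ h => mem_insert_succ (h.trans hi)

theorem late_insert (hi : i ≤ j) : I.late (insert (j + 1) E) i = I.late E i :=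
  late_congr fun _ _ h => mem_insert_succ (h.trans hi)

theorem compl_insert (h1 : 1 ≤ i) (hi : i ≤ j) : I.compl (insert (j + 1) E) i = I.compl E i :=
  compl_congr h1 fun _ _ h => mem_insert_succ (h.trans hi)

theorem partialCost_insert (hi : i ≤ j) :
    I.partialCost (insert (j + 1) E) i = I.partialCost E i :=
  partialCost_congr fun _ _ h => mem_insert_succ (h.trans hi)

theorem Partial.insert (h : I.Partial a E j) (hT : I.early E j + I.p (j + 1) ≤ I.T₁)
    (hk : I.C (j + 1) - I.k ≤ I.early E j + I.p (j + 1)) :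
    I.Partial a (insert (j + 1) E) (j + 1) := by
  have he : I.early (Insert.insert (j + 1) E) (j + 1) = I.early E j + I.p (j + 1) := by
    rw [early_succ, early_insert le_rfl, if_pos (Finset.mem_insert_self _ _)]
  refine ⟨?_, fun i h1 h2 => Finset.mem_insert_of_mem (h.before i h1 h2), ?_,
    h.le.trans (by omega), he.trans_le hT, ?_⟩
  · refine Finset.insert_subset (by simp) (h.sub.trans (Finset.Icc_subset_Icc_right (by omega)))
  · have := h.le
    simp only [Finset.mem_insert, not_or]
    exact ⟨by omega, h.notMem⟩
  · intro i hi
    rcases Finset.mem_insert.1 hi with rfl | hi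
    · rw [he]
      exact hk
    · rw [early_insert (Finset.mem_Icc.1 (h.sub hi)).2]
      exact h.dev i hi

theorem early_add_le (h1 : i < j) (h : j ∈ E) : I.early E i + I.p j ≤ I.early E j := by
  obtain ⟨b, rfl⟩ : ∃ b, j = b + 1 := ⟨j - 1, by omega⟩
  rw [early_succ, if_pos h]
  linarith [I.early_mono E (show i ≤ b by omega)]

theorem late_add_le (h1 : i < j) (h : j ∉ E) : I.late E i + I.p j ≤ I.late E j := by
  obtain ⟨b, rfl⟩ : ∃ b, j = b + 1 := ⟨j - 1, by omega⟩
  rw [late_succ, if_neg h]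
  linarith [I.late_mono E (show i ≤ b by omega)]

theorem C_add_le (h1 : i < j) : I.C i + I.p j ≤ I.C j := by
  obtain ⟨b, rfl⟩ : ∃ b, j = b + 1 := ⟨j - 1, by omega⟩
  rw [C_succ]
  linarith [I.C_mono (show i ≤ b by omega)]

/-- Starting times of a full schedule. -/
noncomputable def fullS (I : Inst) (E : Finset ℕ) (j m i : ℕ) : ℝ := I.fullC E j m i - I.p i

/-- `J_i` belongs to the earlier schedule of the full schedule described by `E`, `j`, `m`. -/
def IsEarly (E : Finset ℕ) (j m i : ℕ) : Prop := (i ≤ j ∧ i ∈ E) ∨ (j < i ∧ i ≤ m)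

/-! ### Feasibility of full schedules -/

theorem fullC_of_early (h : IsEarly E j m i) :
    (i ≤ j ∧ i ∈ E ∧ I.fullC E j m i = I.early E i) ∨
      (j < i ∧ i ≤ m ∧ I.fullC E j m i = I.C i - I.k) := by
  rcases h with ⟨h, hE⟩ | ⟨h, h'⟩
  · left
    simp [fullC, h, compl, hE]
  · right
    simp [fullC, h, h', h.not_ge]

theorem fullC_of_not_early (h : ¬ IsEarly E j m i) :
    (i ≤ j ∧ i ∉ E ∧ I.fullC E j m i = I.late E i) ∨
      (m < i ∧ I.fullC E j m i = I.late E j + (I.C i - I.C m)) := by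
  simp only [IsEarly, not_or, not_and, not_le] at h
  rcases Nat.lt_or_ge j i with h1 | h1
  · right
    have h2 := h.2 h1
    exact ⟨h2, by rw [fullC, if_neg (by omega), if_neg (by omega)]⟩
  · left
    exact ⟨h1, h.1 h1, by rw [fullC, if_pos h1, compl, if_neg (h.1 h1)]⟩

/-- The block of idled jobs starts at `C j - k`, after the compact part of the earlier schedule has
ended. -/
theorem Full.early_lt (h : I.Full a m E j) (hjm : j < m) : I.early E j < I.C j - I.k := by
  have := h.idle hjm
  rw [C_succ] at this
  linarith

theorem Full.fullC_le_T₁ (hS : I.Setup a m) (h : I.Full a m E j) (hi : IsEarly E j m i) :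
    I.fullC E j m i ≤ I.T₁ := by
  rcases fullC_of_early (I := I) hi with ⟨h1, h2, h3⟩ | ⟨h1, h2, h3⟩ <;> rw [h3]
  · exact (I.early_mono E h1).trans h.early_le
  · have := h.le
    have := hS.room (by omega)
    linarith [I.C_mono h2]

theorem Full.le_fullC (h : I.Full a m E j) (hi1 : 1 ≤ i) (hi : IsEarly E j m i) :
    (I.p i : ℝ) ≤ I.fullC E j m i := by
  rcases fullC_of_early (I := I) hi with ⟨h1, h2, h3⟩ | ⟨h1, h2, h3⟩ <;> rw [h3]
  · have := early_add_le (I := I) (show 0 < i by omega) h2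
    simpa using this
  · have := h.early_lt (h1.trans_le h2)
    have := C_add_le (I := I) h1
    linarith [I.early_nonneg E j]

theorem T₂_add_le_fullC (hi1 : 1 ≤ i) (hi : ¬ IsEarly E j m i) :
    I.T₂ + (I.p i : ℝ) ≤ I.fullC E j m i := by
  rcases fullC_of_not_early (I := I) hi with ⟨h1, h2, h3⟩ | ⟨h1, h3⟩ <;> rw [h3]
  · have := late_add_le (I := I) (show 0 < i by omega) h2
    simpa using this
  · have := C_add_le (I := I) h1
    linarith [I.T₂_le_late E j]

/-- On either side of the unavailability interval the jobs run in index order; jobs on different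
sides are separated by the interval itself. -/
theorem Full.ordered (hS : I.Setup a m) (h : I.Full a m E j) {i' : ℕ} (hi1 : 1 ≤ i)
    (hlt : i < i') :
    I.fullC E j m i ≤ I.fullS E j m i' ∨ I.fullC E j m i' ≤ I.fullS E j m i := by
  have hT : (I.T₁ : ℝ) ≤ I.T₂ := by exact_mod_cast hS.valid.T₁_lt_T₂.le
  unfold fullS
  by_cases hi : IsEarly E j m i <;> by_cases hi' : IsEarly E j m i'
  · left
    rcases fullC_of_early (I := I) hi with ⟨h1, h2, h3⟩ | ⟨h1, h2, h3⟩ <;>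
    rcases fullC_of_early (I := I) hi' with ⟨h1', h2', h3'⟩ | ⟨h1', h2', h3'⟩ <;> rw [h3, h3']
    · linarith [early_add_le (I := I) hlt h2']
    · linarith [C_add_le (I := I) h1', h.early_lt (by omega), I.early_mono E h1]
    · omega
    · linarith [C_add_le (I := I) hlt]
  · left
    linarith [h.fullC_le_T₁ hS hi, T₂_add_le_fullC (I := I) (by omega) hi']
  · right
    linarith [h.fullC_le_T₁ hS hi', T₂_add_le_fullC (I := I) (by omega) hi]
  · left
    rcases fullC_of_not_early (I := I) hi with ⟨h1, h2, h3⟩ | ⟨h1, h3⟩ <;>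
    rcases fullC_of_not_early (I := I) hi' with ⟨h1', h2', h3'⟩ | ⟨h1', h3'⟩ <;>
      rw [h3, h3']
    · linarith [late_add_le (I := I) hlt h2']
    · linarith [C_add_le (I := I) h1', I.late_mono E h1]
    · have := h.le_last
      omega
    · linarith [C_add_le (I := I) hlt]

theorem Partial.early_ge (h : I.Partial a E j) (ha : 1 ≤ a) (hi : a ≤ i) :
    I.C (a - 1) ≤ I.early E i := by
  rw [← h.early_before (a - 1) (by omega)]
  exact I.early_mono E (by omega)

/-- Early jobs never complete later than in the original schedule. A late job is delayed by at most
`T₂` minus the early length, which is at least `C (a - 1)`, so the candidate condition bounds every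
delay. Late jobs up to `j` never move forward; those behind `m` can do so only because the jobs `j +
1, …, m` left the later schedule, and `room` bounds this gain by `k`. -/
theorem Full.deviation (hS : I.Setup a m) (h : I.Full a m E j) (hi1 : 1 ≤ i) :
    |I.fullC E j m i - I.C i| ≤ I.k := by
  have hT : (I.T₁ : ℝ) ≤ I.T₂ := by exact_mod_cast hS.valid.T₁_lt_T₂.le
  have hk : (0 : ℝ) ≤ I.k := Nat.cast_nonneg _
  rw [abs_le]
  by_cases hi : IsEarly E j m i
  · rcases fullC_of_early (I := I) hi with ⟨h1, h2, h3⟩ | ⟨h1, h2, h3⟩ <;> rw [h3]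
    · have := h.dev i h2
      have := I.early_le_C E i
      constructor <;> linarith
    · constructor <;> linarith
  · rcases fullC_of_not_early (I := I) hi with ⟨h1, h2, h3⟩ | ⟨h1, h3⟩ <;>
      rw [h3, late_eq]
    · have := I.early_mono E h1
      have := h.early_le
      have hs := hS.shift
      have ha := hS.one_le
      have hai : a ≤ i := by
        by_contra hc
        exact h2 (h.before i hi1 (by omega))
      have := h.early_ge ha hai
      constructor <;> linarith
    · have := h.early_le
      have hs := hS.shift
      have := h.early_ge hS.one_le h.le
      have := I.C_mono h.le_last
      refine ⟨?_, by linarith⟩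
      rcases h.le_last.eq_or_lt with rfl | hjm
      · linarith
      · have := hS.room (h.le.trans_lt hjm)
        have := I.early_le_C E j
        linarith

theorem Full.feasible (hS : I.Setup a m) (h : I.Full a m E j) {S : ℕ → ℝ}
    (hSS : ∀ i, 1 ≤ i → i ≤ I.n → S i = I.fullS E j m i) : I.Feasible S := by
  have hc : ∀ i, I.fullS E j m i + I.p i = I.fullC E j m i := fun i => by simp [fullS]
  refine ⟨fun i h1 h2 => ?_, fun i i' h1 h2 h1' h2' hne => ?_, fun i h1 h2 => ?_,
    fun i h1 h2 => ?_⟩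
  · rw [hSS i h1 h2, fullS]
    by_cases hi : IsEarly E j m i
    · linarith [h.le_fullC h1 hi]
    · have : (0 : ℝ) ≤ I.T₂ := Nat.cast_nonneg _
      linarith [T₂_add_le_fullC (I := I) h1 hi]
  · rw [hSS i h1 h2, hSS i' h1' h2', hc, hc]
    rcases lt_or_gt_of_ne hne with hlt | hlt
    · exact h.ordered hS h1 hlt
    · exact (h.ordered hS h1' hlt).symm
  · rw [hSS i h1 h2, hc]
    by_cases hi : IsEarly E j m i
    · exact Or.inl (h.fullC_le_T₁ hS hi)
    · right
      rw [fullS]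
      linarith [T₂_add_le_fullC (I := I) h1 hi]
  · rw [hSS i h1 h2, hc, ← C_eq]
    exact h.deviation hS h1

theorem Full.startsLater (hS : I.Setup a m) (h : I.Full a m E j) {S : ℕ → ℝ}
    (hSS : ∀ i, 1 ≤ i → i ≤ I.n → S i = I.fullS E j m i) : I.StartsLater a S := by
  refine ⟨?_, fun i h1 h2 => ?_⟩
  · rw [hSS a hS.one_le hS.le_n, fullS, fullC, if_pos h.le, compl, if_neg h.notMem,
      h.late_a hS.one_le]
    ring
  · rw [hSS i h1 (by linarith [hS.le_n]), fullS, sub_add_cancel]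
    exact h.fullC_le_T₁ hS (Or.inl ⟨h2.le.trans h.le, h.before i h1 h2⟩)

theorem fullCost_eq_cost {S : ℕ → ℝ} (hSS : ∀ i, 1 ≤ i → i ≤ I.n → S i = I.fullS E j m i) :
    I.fullCost E j m = I.cost S := by
  refine Finset.sum_congr rfl fun i hi => ?_
  obtain ⟨h1, h2⟩ := Finset.mem_Icc.1 hi
  rw [hSS i h1 h2, fullS, sub_add_cancel]

theorem fullC_nonneg (h : I.Full a m E j) (hi1 : 1 ≤ i) : 0 ≤ I.fullC E j m i := by
  by_cases hi : IsEarly E j m i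
  · exact (Nat.cast_nonneg _).trans (h.le_fullC hi1 hi)
  · exact (add_nonneg (Nat.cast_nonneg _) (Nat.cast_nonneg _)).trans (T₂_add_le_fullC hi1 hi)

theorem fullC_le (h : I.Full a m E j) : I.fullC E j m i ≤ I.C i + I.T₂ := by
  have hk : (0 : ℝ) ≤ I.k := Nat.cast_nonneg _
  have hT : (0 : ℝ) ≤ I.T₂ := Nat.cast_nonneg _
  unfold fullC
  split
  · exact I.compl_le E i
  · split
    · linarith
    · have := I.C_mono h.le_last
      rw [late_eq]
      linarith [I.early_nonneg E j]

theorem partialCost_le_fullCost (h : I.Full a m E j) (hm : m ≤ I.n) :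
    I.partialCost E j ≤ I.fullCost E j m := by
  rw [fullCost, sum_Icc_eq_add_sum_Ioc _ (h.le_last.trans hm), partialCost]
  refine le_add_of_le_of_nonneg (le_of_eq (Finset.sum_congr rfl fun i hi => ?_))
    (Finset.sum_nonneg fun i hi => ?_)
  · rw [fullC, if_pos (Finset.mem_Icc.1 hi).2]
  · exact mul_nonneg (Nat.cast_nonneg _)
      (fullC_nonneg h (by have := Finset.mem_Ioc.1 hi; omega))

/-! ### Lower bounds for a feasible constrained schedule -/

open Classical in
/-- The jobs of the earlier schedule. -/
noncomputable def earlyJobs (I : Inst) (S : ℕ → ℝ) : Finset ℕ :=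
  (Finset.Icc 1 I.n).filter fun i => S i + I.p i ≤ I.T₁

variable {S : ℕ → ℝ}

theorem mem_earlyJobs : i ∈ I.earlyJobs S ↔ (1 ≤ i ∧ i ≤ I.n) ∧ S i + I.p i ≤ I.T₁ := by
  simp [earlyJobs]

theorem Valid.p_pos' (hI : I.Valid) (h1 : 1 ≤ i) (h2 : i ≤ I.n) : (0 : ℝ) < I.p i := by
  exact_mod_cast hI.p_pos i h1 h2

theorem Valid.w_pos' (hI : I.Valid) (h1 : 1 ≤ i) (h2 : i ≤ I.n) : (0 : ℝ) < I.w i := by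
  exact_mod_cast hI.w_pos i h1 h2

theorem early_earlyJobs_le (hI : I.Valid) (hF : I.Feasible S) (hj : j ≤ I.n) :
    I.early (I.earlyJobs S) j ≤ I.T₁ := by
  refine (I.early_mono _ hj).trans ?_
  rw [early, ← Finset.sum_filter]
  have hm : ∀ i ∈ (Finset.Icc 1 I.n).filter (· ∈ I.earlyJobs S),
      (1 ≤ i ∧ i ≤ I.n) ∧ S i + I.p i ≤ I.T₁ := fun i hi =>
    mem_earlyJobs.1 (Finset.mem_filter.1 hi).2
  have := sum_le_of_disjoint ((Finset.Icc 1 I.n).filter (· ∈ I.earlyJobs S)) (S := S)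
    (p := fun i => (I.p i : ℝ)) (t := 0)
    (fun i hi => hI.p_pos' (hm i hi).1.1 (hm i hi).1.2)
    (fun i hi => hF.nonneg i (hm i hi).1.1 (hm i hi).1.2)
    (fun i hi i' hi' hne => hF.disjoint i i' (hm i hi).1.1 (hm i hi).1.2 (hm i' hi').1.1
      (hm i' hi').1.2 hne)
    I.T₁ (Nat.cast_nonneg _) (fun i hi => (hm i hi).2)
  simpa using this

theorem C_sub_le_of_mem_earlyJobs (hF : I.Feasible S) (hi : i ∈ I.earlyJobs S) :
    I.C i - I.k ≤ I.T₁ := by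
  obtain ⟨⟨h1, h2⟩, h3⟩ := mem_earlyJobs.1 hi
  have := (abs_le.1 (hF.deviation i h1 h2)).1
  rw [← C_eq] at this
  linarith

/-- The bound given by Smith's rule on both sides of the unavailability interval and the maximum
deviation of the jobs `J_{j+1}, …, J_m`. -/
theorem fullCost_le_cost (hI : I.Valid) (hF : I.Feasible S) (hj : j ≤ m)
    (hm : ∀ i, m < i → i ≤ I.n → (I.T₁ : ℝ) < I.C i - I.k) :
    I.fullCost (I.earlyJobs S) j m ≤ I.cost S := by
  set E := I.earlyJobs S with hE
  set N := Finset.Icc 1 I.n with hN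
  have hmem : ∀ i, i ∈ N ↔ 1 ≤ i ∧ i ≤ I.n := fun i => by simp [hN]
  have hwspt : ∀ i i', 1 ≤ i → i ≤ i' → i' ≤ I.n → (I.p i : ℝ) * I.w i' ≤ I.p i' * I.w i := by
    intro i i' h1 h2 h3
    have := hI.wspt i i' h1 h2 h3
    rwa [div_le_div_iff₀ (hI.w_pos' h1 (h2.trans h3)) (hI.w_pos' (h1.trans h2) h3)] at this
  have smith : ∀ (A : Finset ℕ) (t : ℝ), A ⊆ N → (∀ i ∈ A, t ≤ S i) →
      ∑ i ∈ A, (I.w i : ℝ) * (t + ∑ i' ∈ A, if i' ≤ i then (I.p i' : ℝ) else 0) ≤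
        ∑ i ∈ A, (I.w i : ℝ) * (S i + I.p i) := by
    intro A t hA ht
    have hA' : ∀ i ∈ A, 1 ≤ i ∧ i ≤ I.n := fun i hi => (hmem i).1 (hA hi)
    exact smith_rule A (fun i hi => hI.p_pos' (hA' i hi).1 (hA' i hi).2)
      (fun i hi => hI.w_pos' (hA' i hi).1 (hA' i hi).2) ht
      (fun i hi i' hi' hne => hF.disjoint i i' (hA' i hi).1 (hA' i hi).2 (hA' i' hi').1
        (hA' i' hi').2 hne)
      (fun i hi i' hi' hle => hwspt i i' (hA' i hi).1 hle (hA' i' hi').2)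
  classical
  -- The three groups are bounded separately: `A` is packed from time `0`, each job of `M` is
  -- bounded by its own deviation, and `B` is packed from time `T₂`.
  set A := N.filter fun i => i ≤ j ∧ i ∈ E with hA
  set M := N.filter fun i => j < i ∧ i ≤ m with hM
  set B := N.filter fun i => (i ≤ j ∧ i ∉ E) ∨ m < i with hB
  have split3 : ∀ f : ℕ → ℝ, ∑ i ∈ N, f i = ∑ i ∈ A, f i + ∑ i ∈ M, f i + ∑ i ∈ B, f i := by
    intro f
    rw [hA, hM, hB, Finset.sum_filter, Finset.sum_filter, Finset.sum_filter,
      ← Finset.sum_add_distrib, ← Finset.sum_add_distrib]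
    refine Finset.sum_congr rfl fun i _ => ?_
    by_cases h1 : i ≤ j
    · have h2 : ¬ m < i := by omega
      by_cases h3 : i ∈ E <;> simp [h1, h2, h3, h1.not_gt]
    · by_cases h2 : i ≤ m <;> simp [h1, h2, not_le.1 h1, not_lt.2, not_le.1]
  unfold fullCost cost
  rw [split3, split3]
  refine add_le_add (add_le_add ?_ (Finset.sum_le_sum fun i hi => ?_)) ?_
  · refine le_trans (le_of_eq ?_) (smith A 0 (Finset.filter_subset _ _) fun i hi => ?_)
    · refine Finset.sum_congr rfl fun i hi => ?_
      simp only [hA, Finset.mem_filter, hmem] at hi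
      obtain ⟨⟨h1, h2⟩, h3, h4⟩ := hi
      rw [fullC, if_pos h3, compl, if_pos h4, early, zero_add, hA, ← Finset.sum_filter,
        ← Finset.sum_filter, Finset.filter_filter]
      congr 2
      ext i'
      simp only [Finset.mem_filter, Finset.mem_Icc, hmem]
      grind
    · simp only [hA, Finset.mem_filter, hmem] at hi
      exact hF.nonneg i hi.1.1 hi.1.2
  · simp only [hM, Finset.mem_filter, hmem] at hi
    obtain ⟨⟨h1, h2⟩, h3, h4⟩ := hi
    refine mul_le_mul_of_nonneg_left ?_ (Nat.cast_nonneg _)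
    rw [fullC, if_neg (by omega), if_pos h4]
    -- This bound holds on whichever side of the interval `S` places the job.
    have := (abs_le.1 (hF.deviation i h1 h2)).1
    rw [← C_eq] at this
    linarith
  -- Late jobs of `S` that belong to `M` are simply left out; Smith's rule remains valid for the
  -- subset `B`.
  · refine le_trans (le_of_eq ?_) (smith B I.T₂ (Finset.filter_subset _ _) fun i hi => ?_)
    · refine Finset.sum_congr rfl fun i hi => ?_
      simp only [hB, Finset.mem_filter, hmem] at hi
      obtain ⟨⟨h1, h2⟩, h3⟩ := hi
      congr 1
      rw [hB, ← Finset.sum_filter, Finset.filter_filter]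
      rcases h3 with ⟨h3, h4⟩ | h3
      · rw [fullC, if_pos h3, compl, if_neg h4, late]
        congr 1
        rw [Finset.sum_congr rfl fun _ _ => (ite_not _ _ _).symm, ← Finset.sum_filter]
        congr 1
        ext i'
        simp only [Finset.mem_filter, Finset.mem_Icc, hmem]
        grind
      · rw [fullC, if_neg (by omega), if_neg (by omega), late, add_assoc]
        congr 1
        rw [C, C, sum_Icc_eq_add_sum_Ioc _ h3.le, add_sub_cancel_left,
          Finset.sum_congr rfl fun _ _ => (ite_not _ _ _).symm, ← Finset.sum_filter,
          ← Finset.sum_union]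
        · congr 1
          ext i'
          simp only [Finset.mem_union, Finset.mem_Ioc, Finset.mem_filter, Finset.mem_Icc, hmem]
          grind
        · rw [Finset.disjoint_left]
          intro i' h5 h6
          simp only [Finset.mem_Ioc, Finset.mem_filter, Finset.mem_Icc] at h5 h6
          omega
    · simp only [hB, Finset.mem_filter, hmem] at hi
      obtain ⟨⟨h1, h2⟩, h3⟩ := hi
      -- A job behind `m` cannot be early in `S`, because its earliest permitted completion time
      -- exceeds `T₁`.
      refine (hF.avoids i h1 h2).resolve_left fun hc => ?_
      have hiE : i ∈ E := mem_earlyJobs.2 ⟨⟨h1, h2⟩, hc⟩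
      rcases h3 with ⟨h3, h4⟩ | h3
      · exact h4 hiE
      · exact absurd (C_sub_le_of_mem_earlyJobs hF hiE) (not_le.2 (hm i h3 h2))

end Inst

/-! ### Prefix sums of weights and of weighted completion times -/

namespace Inst

noncomputable def wSum (I : Inst) (j : ℕ) : ℝ := ∑ i ∈ Finset.Icc 1 j, (I.w i : ℝ)

/-- Total weighted completion time of `J_1, …, J_j` in `π*`. -/
noncomputable def zSum (I : Inst) (j : ℕ) : ℝ := ∑ i ∈ Finset.Icc 1 j, (I.w i : ℝ) * I.C i

theorem wSum_succ (I : Inst) (j : ℕ) : I.wSum (j + 1) = I.wSum j + I.w (j + 1) :=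
  Finset.sum_Icc_succ_top (by omega) _

theorem zSum_succ (I : Inst) (j : ℕ) :
    I.zSum (j + 1) = I.zSum j + I.w (j + 1) * I.C (j + 1) :=
  Finset.sum_Icc_succ_top (by omega) _

end Inst

/-! ### The preparation -/

/-- The state of the preparation after `m` jobs. -/
structure Pre.UpTo (s : Pre) (I : Inst) (m : ℕ) : Prop where
  P : ∀ i ≤ m, s.P i = I.C i
  W : ∀ i ≤ m, s.W i = I.wSum i
  Z : ∀ i ≤ m, s.Z i = I.zSum i
  sumP : s.sumP = I.C m
  sumW : s.sumW = I.wSum m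
  sumZ : s.sumZ = I.zSum m
  pMin_le : ∀ i, 1 ≤ i → i ≤ m → s.pMin ≤ I.p i
  -- The maximum with `1` covers the initial state, where `pMin` is already set to the first
  -- processing time.
  pMin_eq : ∃ i, 1 ≤ i ∧ i ≤ max 1 m ∧ s.pMin = I.p i
  j₃_le : s.j₃ ≤ m
  room : 1 ≤ s.j₃ → I.C s.j₃ ≤ I.T₁ + I.k
  beyond : ∀ i, s.j₃ < i → i ≤ m → (I.T₁ : ℝ) + I.k < I.C i

noncomputable def preOf (I : Inst) : Pre :=
  (prepare I.n (fun j => I.p j) (fun j => I.w j) I.T₁ I.k).val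

theorem Pre.UpTo.step {s : Pre} {I : Inst} {m : ℕ} (h : s.UpTo I m) :
    Pre.UpTo { P := Function.update s.P (1 + m) (s.sumP + I.p (1 + m))
               W := Function.update s.W (1 + m) (s.sumW + I.w (1 + m))
               Z := Function.update s.Z (1 + m) (s.sumZ + I.w (1 + m) * (s.sumP + I.p (1 + m)))
               sumP := s.sumP + I.p (1 + m)
               sumW := s.sumW + I.w (1 + m)
               sumZ := s.sumZ + I.w (1 + m) * (s.sumP + I.p (1 + m))
               pMin := if decide ((I.p (1 + m) : ℝ) < s.pMin) then (I.p (1 + m) : ℝ) else s.pMin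
               j₃ := if decide (s.sumP + I.p (1 + m) ≤ (I.T₁ : ℝ) + I.k) then 1 + m else s.j₃ }
      I (m + 1) := by
  have hP : s.sumP + I.p (1 + m) = I.C (m + 1) := by rw [h.sumP, add_comm 1 m, I.C_succ]
  have hW : s.sumW + I.w (1 + m) = I.wSum (m + 1) := by rw [h.sumW, add_comm 1 m, I.wSum_succ]
  have hZ : s.sumZ + I.w (1 + m) * I.C (m + 1) = I.zSum (m + 1) := by
    rw [h.sumZ, add_comm 1 m, I.zSum_succ]
  simp only [hP, hW, hZ, decide_eq_true_eq]
  have upd : ∀ (A f : ℕ → ℝ), (∀ i ≤ m, A i = f i) → ∀ i ≤ m + 1,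
      Function.update A (1 + m) (f (m + 1)) i = f i := by
    intro A f hA i hi
    rw [add_comm 1 m]
    rcases eq_or_ne i (m + 1) with rfl | hne
    · simp
    · rw [Function.update_of_ne hne]
      exact hA i (by omega)
  refine ⟨upd _ _ h.P, upd _ _ h.W, upd _ _ h.Z, rfl, rfl, rfl, fun i h1 h2 => ?_, ?_, ?_, ?_, ?_⟩
  · dsimp only
    rcases eq_or_ne i (m + 1) with rfl | hne
    · rw [add_comm 1 m]
      split
      · exact le_rfl
      · linarith
    · have := h.pMin_le i h1 (by omega)
      split
      · linarith
      · exact this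
  · dsimp only
    split
    · exact ⟨1 + m, by omega, by omega, rfl⟩
    · obtain ⟨i, h1, h2, h3⟩ := h.pMin_eq
      exact ⟨i, h1, by omega, h3⟩
  · dsimp only
    have := h.j₃_le
    split <;> omega
  · dsimp only
    split
    · rename_i hle
      intro _
      rw [add_comm 1 m]
      exact hle
    · exact h.room
  · dsimp only
    split
    · intro i h1 h2
      omega
    · rename_i hlt
      intro i h1 h2
      rcases eq_or_ne i (m + 1) with rfl | hne
      · exact not_le.1 hlt
      · exact h.beyond i h1 (by omega)

theorem preOf_upTo (I : Inst) : (preOf I).UpTo I I.n := by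
  unfold preOf prepare
  simp only [val_bind]
  refine loop_induction (fun m s => Pre.UpTo s I m) ?_ fun m s _ hs => hs.step
  refine ⟨?_, ?_, ?_, by simp, by simp [Inst.wSum], by simp [Inst.zSum], fun i h1 h2 => by omega,
    ⟨1, le_rfl, by simp, rfl⟩, le_rfl, fun h => absurd h (by simp), fun i h1 h2 => by simp at h1; omega⟩
  all_goals
    intro i hi
    obtain rfl : i = 0 := by omega
    simp [newArray, Inst.wSum, Inst.zSum]

/-! ### The context of the dynamic program -/

/-- `X` holds the data of the instance, with step ratio `δ`. -/
structure Ctx.For (X : Ctx) (I : Inst) (a : ℕ) (δ : ℝ) : Prop where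
  p_eq : ∀ i, X.p i = I.p i
  w_eq : ∀ i, X.w i = I.w i
  T₁_eq : X.T₁ = I.T₁
  k_eq : X.k = I.k
  n_eq : X.n = I.n
  preP : ∀ i ≤ I.n, X.pre.P i = I.C i
  preW : ∀ i ≤ I.n, X.pre.W i = I.wSum i
  preZ : ∀ i ≤ I.n, X.pre.Z i = I.zSum i
  setup : I.Setup a X.last
  one_lt : 1 < δ
  lnδ_eq : X.grid.lnδ = Real.log δ
  L₁_pos : 0 < X.grid.L₁
  L₁_le : ∀ i, 1 ≤ i → i ≤ I.n → X.grid.L₁ ≤ I.p i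
  L₂_eq : X.grid.L₂ = I.T₂ + I.p a
  L₃_eq : X.grid.L₃ = I.zSum (a - 1) + I.w a * (I.T₂ + I.p a)
  m₁_eq : X.grid.m₁ = (pieces X.grid.lnδ X.grid.L₁ I.T₁).val
  m₂_eq : X.grid.m₂ = (pieces X.grid.lnδ X.grid.L₂ (I.T₂ + I.C I.n)).val
  m₃_eq : X.grid.m₃ = (pieces X.grid.lnδ X.grid.L₃ (I.zSum I.n + I.wSum I.n * I.T₂)).val

/-- It is written with the computed arrays of `preOf`, not with closed forms, so that it agrees
definitionally with the grid built inside `approx`. -/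
noncomputable def gridOf (I : Inst) (a : ℕ) (ε : ℝ) : Grid where
  lnδ := Real.log (1 + ε / (2 * I.n))
  L₁ := (preOf I).pMin
  L₂ := I.T₂ + I.p a
  L₃ := (preOf I).Z (a - 1) + I.w a * (I.T₂ + I.p a)
  m₁ := (pieces (Real.log (1 + ε / (2 * I.n))) (preOf I).pMin I.T₁).val
  m₂ := (pieces (Real.log (1 + ε / (2 * I.n))) (I.T₂ + I.p a) (I.T₂ + (preOf I).P I.n)).val
  m₃ := (pieces (Real.log (1 + ε / (2 * I.n)))
    ((preOf I).Z (a - 1) + I.w a * (I.T₂ + I.p a))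
    ((preOf I).Z I.n + (preOf I).W I.n * I.T₂)).val

noncomputable def ctxOf (I : Inst) (a : ℕ) (ε : ℝ) : Ctx where
  p := fun j => I.p j
  w := fun j => I.w j
  T₁ := I.T₁
  T₂ := I.T₂
  k := I.k
  n := I.n
  last := max a (preOf I).j₃
  pre := preOf I
  grid := gridOf I a ε

variable {I : Inst} {a j : ℕ} {ε δ : ℝ} {X : Ctx} {E : Finset ℕ}

theorem setup_of_candidate (hI : I.Valid) (ha : I.Candidate a) :
    I.Setup a (max a (preOf I).j₃) := by
  have hpre := preOf_upTo I
  obtain ⟨h1, h2, h3⟩ := ha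
  have hn := h2.trans (Inst.j₁_le_n hI)
  refine ⟨hI, h1, hn, Inst.C_le_T₁_of_lt_j₁ hI (by omega), ?_, le_max_left _ _,
    max_le hn hpre.j₃_le, fun h => ?_, fun i hi hi' => ?_⟩
  · rw [← Inst.origS_eq]
    exact_mod_cast h3
  · have h4 : max a (preOf I).j₃ = (preOf I).j₃ := by omega
    rw [h4]
    linarith [hpre.room (by omega)]
  · linarith [hpre.beyond i (by omega) hi']

theorem ctxOf_for (hI : I.Valid) (ha : I.Candidate a) (hε : 0 < ε) :
    (ctxOf I a ε).For I a (1 + ε / (2 * I.n)) := by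
  have hpre := preOf_upTo I
  have hS := setup_of_candidate hI ha
  have hn : 1 ≤ I.n := hS.one_le.trans hS.le_n
  refine ⟨fun _ => rfl, fun _ => rfl, rfl, rfl, rfl, hpre.P, hpre.W, hpre.Z, hS, ?_, rfl, ?_,
    hpre.pMin_le, rfl, ?_, rfl, ?_, ?_⟩
  · have : (0 : ℝ) < I.n := by exact_mod_cast hn
    have : 0 < ε / (2 * I.n) := by positivity
    linarith
  · obtain ⟨i, h1, h2, h3⟩ := hpre.pMin_eq
    change 0 < (preOf I).pMin
    rw [h3]
    exact hI.p_pos' h1 (h2.trans (by omega))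
  · change (preOf I).Z (a - 1) + _ = _
    rw [hpre.Z _ (by have := hS.le_n; omega)]
  · change (pieces _ _ (_ + (preOf I).P I.n)).val = _
    rw [hpre.P _ le_rfl]
    rfl
  · change (pieces _ _ ((preOf I).Z I.n + (preOf I).W I.n * _)).val = _
    rw [hpre.Z _ le_rfl, hpre.W _ le_rfl]
    rfl

/-! ### Quadruples -/

/-- The completion times of `J_j, J_{j-1}, …, J_a`. -/
noncomputable def compList (I : Inst) (a : ℕ) (E : Finset ℕ) (j : ℕ) : List ℝ :=
  ((List.range (j + 1 - a)).map fun d => I.compl E (a + d)).reverse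

/-- The quadruple of the partial schedule of `J_1, …, J_j` with early jobs `E`. -/
noncomputable def quadOf (I : Inst) (a : ℕ) (E : Finset ℕ) (j : ℕ) : Quad where
  j := j
  ℓ₁ := I.early E j
  ℓ₂ := I.late E j
  Z := I.partialCost E j
  comp := compList I a E j

/-- The quadruple of the full schedule described by `E`, `j` and `m`. -/
noncomputable def fullOf (I : Inst) (a m : ℕ) (E : Finset ℕ) (j : ℕ) : Quad where
  j := j
  ℓ₁ := if j < m then I.C m - I.k else I.early E j
  ℓ₂ := I.late E j + (I.C I.n - I.C m)
  Z := I.fullCost E j m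
  comp := compList I a E j

theorem compList_succ (haj : a ≤ j + 1) :
    compList I a E (j + 1) = I.compl E (j + 1) :: compList I a E j := by
  unfold compList
  have h1 : j + 1 + 1 - a = (j + 1 - a) + 1 := by omega
  have h2 : a + (j + 1 - a) = j + 1 := by omega
  simp [h1, List.range_succ, h2]

theorem compList_insert (ha : 1 ≤ a) :
    compList I a (insert (j + 1) E) j = compList I a E j := by
  unfold compList
  congr 1
  refine List.map_congr_left fun d hd => ?_
  have := List.mem_range.1 hd
  exact Inst.compl_insert (by omega) (by omega)

theorem compList_length : (compList I a E j).length = j + 1 - a := by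
  simp [compList]

namespace Ctx.For

variable (hX : X.For I a δ)
include hX

theorem lnδ_pos : 0 < X.grid.lnδ := by
  rw [hX.lnδ_eq]
  exact Real.log_pos hX.one_lt

theorem p_a_pos : (0 : ℝ) < I.p a := hX.setup.valid.p_pos' hX.setup.one_le hX.setup.le_n

theorem L₂_pos : 0 < X.grid.L₂ := by
  rw [hX.L₂_eq]
  have := hX.p_a_pos
  positivity

theorem L₃_pos : 0 < X.grid.L₃ := by
  rw [hX.L₃_eq]
  have h1 := hX.p_a_pos
  have h2 := hX.setup.valid.w_pos' hX.setup.one_le hX.setup.le_n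
  have h3 : 0 ≤ I.zSum (a - 1) :=
    Finset.sum_nonneg fun i _ => mul_nonneg (Nat.cast_nonneg _) (I.C_nonneg i)
  positivity

theorem fits {e : Quad} (h₁ : e.ℓ₁ ≤ 0 ∨ X.grid.L₁ ≤ e.ℓ₁) (u₁ : e.ℓ₁ ≤ I.T₁)
    (h₂ : X.grid.L₂ ≤ e.ℓ₂) (u₂ : e.ℓ₂ ≤ I.T₂ + I.C I.n) (h₃ : X.grid.L₃ ≤ e.Z)
    (u₃ : e.Z ≤ I.zSum I.n + I.wSum I.n * I.T₂) : X.grid.Fits e := by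
  refine ⟨?_, ?_, ?_⟩
  · change Timed.val (if decide (e.ℓ₁ ≤ 0) = true then _ else _) ≤ _
    simp only [decide_eq_true_eq]
    split
    · exact Nat.zero_le _
    · rw [hX.m₁_eq]
      exact locate_le_pieces hX.lnδ_pos hX.L₁_pos (h₁.resolve_left ‹_›) u₁
  · rw [hX.m₂_eq]
    exact locate_le_pieces hX.lnδ_pos hX.L₂_pos h₂ u₂
  · rw [hX.m₃_eq]
    exact locate_le_pieces hX.lnδ_pos hX.L₃_pos h₃ u₃

/-- Either there is no early job, which is the box `[0, 0]`, or a single early job already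
contributes at least `p_min`. -/
theorem early_range (hj : j ≤ I.n) : I.early E j ≤ 0 ∨ X.grid.L₁ ≤ I.early E j := by
  by_cases h : ∃ i ∈ E, 1 ≤ i ∧ i ≤ j
  · obtain ⟨i, hi, h1, h2⟩ := h
    right
    have := Inst.early_add_le (I := I) (show 0 < i by omega) hi
    rw [Inst.early_zero, zero_add] at this
    exact (hX.L₁_le i h1 (h2.trans hj)).trans (this.trans (I.early_mono E h2))
  · left
    refine le_of_eq (Finset.sum_eq_zero fun i hi => if_neg fun hE => h ⟨i, hE, ?_⟩)
    simpa using hi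

/-- All constrained partial schedules agree up to `J_a`, so the lower end of the third range is
their common cost at that level, and costs only grow from there. -/
theorem partialCost_a (h : I.Partial a E j) : I.partialCost E a = X.grid.L₃ := by
  have ha := hX.setup.one_le
  obtain ⟨b, rfl⟩ : ∃ b, a = b + 1 := ⟨a - 1, by omega⟩
  rw [hX.L₃_eq, Inst.partialCost_succ, Inst.compl, if_neg h.notMem, h.late_a ha]
  congr 1
  refine Finset.sum_congr rfl fun i hi => ?_
  obtain ⟨h1, h2⟩ := Finset.mem_Icc.1 hi
  rw [Inst.compl, if_pos (h.before i h1 (by omega)), h.early_before i (by omega)]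

theorem L₂_le (h : I.Partial a E j) : X.grid.L₂ ≤ I.late E j := by
  rw [hX.L₂_eq, ← h.late_a hX.setup.one_le]
  exact I.late_mono E h.le

theorem L₃_le (h : I.Partial a E j) : X.grid.L₃ ≤ I.partialCost E j := by
  rw [← hX.partialCost_a h]
  exact I.partialCost_mono E h.le

omit hX in
theorem sum_le_zSum_add (f : ℕ → ℝ) (hf : ∀ i, f i ≤ I.C i + I.T₂) :
    ∑ i ∈ Finset.Icc 1 I.n, (I.w i : ℝ) * f i ≤ I.zSum I.n + I.wSum I.n * I.T₂ := by
  rw [Inst.zSum, Inst.wSum, Finset.sum_mul, ← Finset.sum_add_distrib]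
  refine Finset.sum_le_sum fun i _ => ?_
  rw [← mul_add]
  exact mul_le_mul_of_nonneg_left (hf i) (Nat.cast_nonneg _)

theorem quad_fits (h : I.Partial a E j) (hj : j ≤ X.last) : X.grid.Fits (quadOf I a E j) := by
  have hjn := hj.trans hX.setup.last_le
  refine hX.fits (hX.early_range hjn) h.early_le (hX.L₂_le h) ?_ (hX.L₃_le h) ?_
  · change I.late E j ≤ _
    rw [Inst.late_eq]
    linarith [I.early_nonneg E j, I.C_mono hjn]
  · exact (I.partialCost_mono E hjn).trans (sum_le_zSum_add _ (I.compl_le E))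

theorem full_fits (h : I.Full a X.last E j) : X.grid.Fits (fullOf I a X.last E j) := by
  have hjn := h.le_last.trans hX.setup.last_le
  have hmn := I.C_mono hX.setup.last_le
  refine hX.fits ?_ ?_ ((hX.L₂_le h.toPartial).trans ?_) ?_
    ((hX.L₃_le h.toPartial).trans (Inst.partialCost_le_fullCost h hX.setup.last_le))
    (sum_le_zSum_add _ fun i => Inst.fullC_le h)
  · change (if j < X.last then _ else _) ≤ _ ∨ _ ≤ (if j < X.last then _ else _)
    split
    · rename_i hlt
      right
      -- The completion time of the idled block exceeds the length of its first job, hence `p_min`.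
      have h1 := h.idle hlt
      have h2 := hX.L₁_le (j + 1) (by omega) (Nat.le_trans hlt hX.setup.last_le)
      have h3 := I.C_mono (show j + 1 ≤ X.last from hlt)
      linarith [I.early_nonneg E j]
    · exact hX.early_range hjn
  · change (if j < X.last then _ else _) ≤ _
    split
    · exact hX.setup.room (h.le.trans_lt ‹_›)
    · exact h.early_le
  · exact le_add_of_nonneg_right (by linarith)
  · change I.late E j + _ ≤ _
    rw [Inst.late_eq]
    linarith [I.early_nonneg E j, I.C_mono h.le_last]

theorem le_of_cell₂_eq {e e' : Quad} (h : X.grid.L₂ ≤ e.ℓ₂) (h' : X.grid.L₂ ≤ e'.ℓ₂)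
    (hc : X.grid.cell₂ e' = X.grid.cell₂ e) : e'.ℓ₂ ≤ δ * e.ℓ₂ := by
  unfold Grid.cell₂ at hc
  rw [hX.lnδ_eq] at hc
  exact le_mul_of_locate_eq hX.one_lt hX.L₂_pos h h' hc

theorem le_of_cell₃_eq {e e' : Quad} (h : X.grid.L₃ ≤ e.Z) (h' : X.grid.L₃ ≤ e'.Z)
    (hc : X.grid.cell₃ e' = X.grid.cell₃ e) : e'.Z ≤ δ * e.Z := by
  unfold Grid.cell₃ at hc
  rw [hX.lnδ_eq] at hc
  exact le_mul_of_locate_eq hX.one_lt hX.L₃_pos h h' hc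

/-! ### One step of the dynamic program -/

omit hX in
theorem sum_Ioc_eq_sub (f : ℕ → ℝ) {m n : ℕ} (h : m ≤ n) :
    ∑ i ∈ Finset.Ioc m n, f i = ∑ i ∈ Finset.Icc 1 n, f i - ∑ i ∈ Finset.Icc 1 m, f i := by
  rw [sum_Icc_eq_add_sum_Ioc f h]
  ring

omit hX in
theorem sum_Ioc_weighted (c : ℝ) {m n : ℕ} (h : m ≤ n) :
    ∑ i ∈ Finset.Ioc m n, (I.w i : ℝ) * (I.C i + c) =
      (I.zSum n - I.zSum m) + (I.wSum n - I.wSum m) * c := by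
  simp only [mul_add, Finset.sum_add_distrib, ← Finset.sum_mul]
  rw [sum_Ioc_eq_sub _ h, sum_Ioc_eq_sub _ h]
  rfl

/-- The appended jobs are those of the original schedule, all shifted by `ℓ - C m`; prefix sums
therefore give their cost in constant time. -/
theorem appendLast_val (ℓ : ℝ) : (appendLast X ℓ).val =
    (ℓ + (I.C I.n - I.C X.last),
      ∑ i ∈ Finset.Ioc X.last I.n, (I.w i : ℝ) * (ℓ + (I.C i - I.C X.last))) := by
  have hm := hX.setup.last_le
  have h1 : ∀ i, (I.w i : ℝ) * (ℓ + (I.C i - I.C X.last)) =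
      (I.w i : ℝ) * (I.C i + (ℓ - I.C X.last)) := fun i => by ring
  simp only [h1]
  rw [sum_Ioc_weighted _ hm]
  simp only [appendLast, Timed.read, Timed.sub, Timed.add, Timed.mul, val_bind, val_pure, hX.n_eq,
    hX.preP _ hm, hX.preW _ hm, hX.preZ _ hm, hX.preP _ le_rfl, hX.preW _ le_rfl,
    hX.preZ _ le_rfl]

omit hX in
theorem case₁_val (h : I.Partial a E j) (T : Table) :
    (case₁ X (j + 1) (I.p (j + 1)) (I.w (j + 1)) (quadOf I a E j) T).val =
      (save X.grid T (quadOf I a E (j + 1))).val := by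
  have hn := h.succ_notMem
  have he : I.early E (j + 1) = I.early E j := by rw [Inst.early_succ, if_neg hn, add_zero]
  have hl : I.late E (j + 1) = I.late E j + I.p (j + 1) := by rw [Inst.late_succ, if_neg hn]
  have hc : I.compl E (j + 1) = I.late E j + I.p (j + 1) := by rw [Inst.compl, if_neg hn, hl]
  simp only [case₁, Timed.add, Timed.mul, Timed.cons, val_bind, quadOf, he, hl,
    Inst.partialCost_succ, hc, compList_succ (I := I) (E := E) (h.le.trans (Nat.le_succ j))]

theorem case₂_val (h : I.Partial a E j) (T : Table) :
    (case₂ X (j + 1) (I.w (j + 1)) (I.early E j + I.p (j + 1)) (quadOf I a E j) T).val =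
      (save X.grid T (quadOf I a (insert (j + 1) E) (j + 1))).val := by
  have hn := Finset.mem_insert_self (j + 1) E
  have he : I.early (insert (j + 1) E) (j + 1) = I.early E j + I.p (j + 1) := by
    rw [Inst.early_succ, if_pos hn, Inst.early_insert le_rfl]
  have hl : I.late (insert (j + 1) E) (j + 1) = I.late E j := by
    rw [Inst.late_succ, if_pos hn, Inst.late_insert le_rfl, add_zero]
  have hc : I.compl (insert (j + 1) E) (j + 1) = I.early E j + I.p (j + 1) := by
    rw [Inst.compl, if_pos hn, he]
  simp only [case₂, Timed.add, Timed.mul, Timed.cons, val_bind, quadOf, he, hl,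
    Inst.partialCost_succ, hc, Inst.partialCost_insert le_rfl,
    compList_succ (I := I) (E := insert (j + 1) E) (h.le.trans (Nat.le_succ j)),
    compList_insert hX.setup.one_le]

theorem case₃_val (hj : j < X.last) (T : Table) :
    (case₃ X (quadOf I a E j) T).val = (save X.grid T (fullOf I a X.last E j)).val := by
  have hm := hX.setup.last_le
  have hZ : I.partialCost E j + ((I.zSum X.last - I.zSum j) - I.k * (I.wSum X.last - I.wSum j)) +
      ∑ i ∈ Finset.Ioc X.last I.n, (I.w i : ℝ) * (I.late E j + (I.C i - I.C X.last)) =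
      I.fullCost E j X.last := by
    rw [Inst.fullCost_eq _ _ hj.le hm]
    simp only [sub_eq_add_neg (I.C _) (I.k : ℝ)]
    rw [sum_Ioc_weighted _ hj.le]
    ring
  simp only [case₃, Timed.read, Timed.sub, Timed.add, Timed.mul, val_bind, hX.appendLast_val,
    quadOf, fullOf, hX.preP _ hm, hX.preW _ hm, hX.preZ _ hm, hX.preW _ (hj.le.trans hm),
    hX.preZ _ (hj.le.trans hm), hX.k_eq, hZ, if_pos hj]

theorem complete_val (T : Table) :
    (complete X (quadOf I a E X.last) T).val =
      (save X.grid T (fullOf I a X.last E X.last)).val := by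
  have hm := hX.setup.last_le
  have hZ : I.partialCost E X.last +
      ∑ i ∈ Finset.Ioc X.last I.n, (I.w i : ℝ) * (I.late E X.last + (I.C i - I.C X.last)) =
      I.fullCost E X.last X.last := by
    rw [Inst.fullCost_eq _ _ le_rfl hm]
    simp
  simp only [complete, Timed.add, val_bind, hX.appendLast_val, quadOf, fullOf, hZ,
    if_neg (lt_irrefl _)]

theorem extend_val (h : I.Partial a E j) (hj : j < X.last) (s : Table × Table) :
    (extend X (quadOf I a E j) s).val =
      (if I.early E j + I.p (j + 1) ≤ I.T₁ ∧ I.C (j + 1) - I.k ≤ I.early E j + I.p (j + 1) then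
          (save X.grid (save X.grid s.1 (quadOf I a E (j + 1))).val
            (quadOf I a (insert (j + 1) E) (j + 1))).val
        else (save X.grid s.1 (quadOf I a E (j + 1))).val,
        if I.early E j + I.p (j + 1) < I.C (j + 1) - I.k ∧ I.C (j + 1) - I.k ≤ I.T₁ then
          (save X.grid s.2 (fullOf I a X.last E j)).val else s.2) := by
  have hm := hX.setup.last_le
  have h1 := case₁_val (X := X) h s.1
  have h2 := hX.case₂_val h (save X.grid s.1 (quadOf I a E (j + 1))).val
  have h3 := hX.case₃_val (E := E) hj s.2
  simp only [extend, Timed.addN, Timed.read, Timed.add, Timed.sub, Timed.le, Timed.lt, val_bind]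
  have ej : (quadOf I a E j).j = j := rfl
  have eℓ : (quadOf I a E j).ℓ₁ = I.early E j := rfl
  simp only [ej, eℓ, hX.p_eq, hX.w_eq, hX.preP (j + 1) (by omega), hX.k_eq, hX.T₁_eq, h1,
    Bool.and_eq_true, decide_eq_true_eq]
  split <;> simp only [val_bind, val_pure, h2] <;> split <;> simp only [val_bind, val_pure, h3]

end Ctx.For

/-! ### Backtracking -/

theorem loop_write {lo m : ℕ} {body : ℕ → (ℕ → ℝ) → Timed (ℕ → ℝ)} (f : ℕ → ℝ) (A : ℕ → ℝ)
    (h : ∀ i A, lo ≤ i → i < lo + m → (body i A).val = Function.update A i (f i)) :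
    (loop lo m body A).val = fun i => if lo ≤ i ∧ i < lo + m then f i else A i := by
  refine loop_induction (fun d B => d ≤ m → B = fun i => if lo ≤ i ∧ i < lo + d then f i else A i)
    (fun _ => ?_) (fun d B hd hB hd' => ?_) le_rfl
  · funext i
    rw [if_neg (by omega)]
  · rw [h _ _ (by omega) (by omega), hB hd.le]
    funext i
    rcases eq_or_ne i (lo + d) with rfl | hne
    · rw [Function.update_self, if_pos (by omega)]
    · rw [Function.update_of_ne hne]
      exact if_congr (by omega) rfl rfl

/-- The list is stored backwards, so its head belongs to the largest index and the writing proceeds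
downwards. -/
theorem unwind_val {a : ℕ} (ha : 1 ≤ a) (f : ℕ → ℝ) (m : ℕ) (A : ℕ → ℝ) :
    (unwind ((List.range m).map fun d => f (a + d)).reverse (a + m - 1) A).val =
      fun i => if a ≤ i ∧ i < a + m then f i else A i := by
  induction m generalizing A with
  | zero =>
    funext i
    rw [if_neg (by omega)]
    rfl
  | succ m ih =>
    rw [List.range_succ, List.map_append, List.reverse_append]
    have h1 : a + (m + 1) - 1 = a + m := by omega
    rw [h1]
    change (unwind ((List.range m).map fun d => f (a + d)).reverse (a + m - 1)
      (Function.update A (a + m) (f (a + m)))).val = _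
    rw [ih]
    funext i
    rcases eq_or_ne i (a + m) with rfl | hne
    · rw [if_neg (by omega), if_pos (by omega), Function.update_self]
    · rw [Function.update_of_ne hne]
      exact if_congr (by omega) rfl rfl

theorem unwind_compList {I : Inst} {a j : ℕ} {E : Finset ℕ} (ha : 1 ≤ a) (haj : a ≤ j)
    (A : ℕ → ℝ) : (unwind (compList I a E j) j A).val =
      fun i => if a ≤ i ∧ i ≤ j then I.compl E i else A i := by
  have h := unwind_val ha (I.compl E) (j + 1 - a) A
  rw [show a + (j + 1 - a) - 1 = j by omega] at h
  unfold compList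
  rw [h]
  funext i
  exact if_congr (by omega) rfl rfl

namespace Ctx.For

variable {I : Inst} {a j : ℕ} {δ : ℝ} {X : Ctx} {E : Finset ℕ} (hX : X.For I a δ)
include hX

/-- The four writing passes cover the disjoint ranges `[1, a - 1]`, `[a, j]`, `[j + 1, last]` and
`[last + 1, n]`, which match the cases of `fullC`; a last pass subtracts the processing times. -/
theorem backtrack_val (h : I.Full a X.last E j) {i : ℕ} (h1 : 1 ≤ i) (hi : i ≤ I.n) :
    (backtrack X a (fullOf I a X.last E j)).val i = I.fullS E j X.last i := by
  have ha := hX.setup.one_le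
  have haj := h.le
  have hjm := h.le_last
  have hmn := hX.setup.last_le
  have ej : (fullOf I a X.last E j).j = j := rfl
  have ec : (fullOf I a X.last E j).comp = compList I a E j := rfl
  have eℓ : (fullOf I a X.last E j).ℓ₂ = I.late E j + (I.C I.n - I.C X.last) := rfl
  simp only [backtrack, val_bind, ej, ec, eℓ, addN, subN, newArray]
  rw [loop_write (lo := 1) (m := a - 1) (fun i => I.C i) _ fun i A _ hi => by
    simp only [val_bind, Timed.read, Timed.write]
    rw [hX.preP i (by omega)]]
  rw [unwind_compList ha haj]
  rw [loop_write (lo := j + 1) (m := X.last - j) (fun i => I.C i - I.k) _ fun i A _ hi => by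
    simp only [val_bind, Timed.read, Timed.write, Timed.sub]
    rw [hX.preP i (by omega), hX.k_eq]]
  rw [loop_write (lo := X.last + 1) (m := X.n - X.last)
    (fun i => I.late E j + (I.C i - I.C X.last)) _ fun i A _ hi => by
    rw [hX.n_eq] at hi
    simp only [val_bind, Timed.read, Timed.write, Timed.sub, Timed.add]
    rw [hX.preP i (by omega), hX.n_eq, hX.preP _ le_rfl]
    congr 1
    ring]
  rw [loop_write (lo := 1) (m := X.n) (fun i => _ - I.p i) _ fun i A _ hi => by
    simp only [val_bind, Timed.read, Timed.write, Timed.sub]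
    rw [hX.p_eq]]
  simp only [hX.n_eq]
  rw [if_pos (by omega), Inst.fullS, Inst.fullC]
  congr 1
  by_cases c1 : i ≤ j
  · rw [if_neg (by omega), if_neg (by omega), if_pos c1]
    by_cases c2 : a ≤ i
    · rw [if_pos ⟨c2, c1⟩]
    · rw [if_neg (by omega), if_pos (by omega), Inst.compl,
        if_pos (h.before i h1 (by omega)), h.early_before i (by omega)]
  · by_cases c2 : i ≤ X.last
    · rw [if_neg (by omega), if_pos (by omega), if_neg c1, if_pos c2]
    · rw [if_pos (by omega), if_neg c1, if_neg c2]

end Ctx.For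

/-! ### The dynamic program -/

/-- Quadruples saved at level `j`. -/
def IsLevel (I : Inst) (a j : ℕ) (e : Quad) : Prop :=
  ∃ E, I.Partial a E j ∧ e = quadOf I a E j

/-- Quadruples saved for full schedules. -/
def IsFull (I : Inst) (a m : ℕ) (e : Quad) : Prop :=
  ∃ E j, I.Full a m E j ∧ e = fullOf I a m E j

/-- The boxes of full schedules account for a schedule of cost at most `B`. -/
def CoversFull (I : Inst) (a m : ℕ) (G : Grid) (B : ℝ) (T : Table) : Prop :=
  ∃ e, IsFull I a m e ∧ Covers G T e ∧ e.Z ≤ B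

theorem CoversFull.save {I : Inst} {a m : ℕ} {G : Grid} {B : ℝ} {T : Table}
    (h : CoversFull I a m G B T) (e : Quad) : CoversFull I a m G B (save G T e).val := by
  obtain ⟨e₀, h0, h1, h2⟩ := h
  exact ⟨e₀, h0, h1.save e, h2⟩

/-- `e` is at least as good as the partial schedule of `J_1, …, J_j` given by `E`, up to `D`. -/
structure Near (I : Inst) (E : Finset ℕ) (j : ℕ) (D : ℝ) (e : Quad) : Prop where
  ℓ₁ : e.ℓ₁ ≤ I.early E j
  ℓ₂ : e.ℓ₂ ≤ D * I.late E j
  Z : e.Z ≤ D * I.partialCost E j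

/-- The boxes of level `j` account for the partial schedule given by `E`, up to `D`. -/
def CoversLevel (I : Inst) (a : ℕ) (G : Grid) (E : Finset ℕ) (j : ℕ) (D : ℝ) (T : Table) : Prop :=
  ∃ e, IsLevel I a j e ∧ Covers G T e ∧ Near I E j D e

theorem CoversLevel.save {I : Inst} {a j : ℕ} {G : Grid} {E : Finset ℕ} {D : ℝ} {T : Table}
    (h : CoversLevel I a G E j D T) (e : Quad) : CoversLevel I a G E j D (save G T e).val := by
  obtain ⟨e₀, h0, h1, h2⟩ := h
  exact ⟨e₀, h0, h1.save e, h2⟩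

/-- The two tables hold quadruples of level `j` and of full schedules. -/
def Valid₂ (I : Inst) (a m : ℕ) (G : Grid) (j : ℕ) (s : Table × Table) : Prop :=
  Sound G (IsLevel I a j) s.1 ∧ Sound G (IsFull I a m) s.2

namespace Ctx.For

variable {I : Inst} {a j : ℕ} {δ : ℝ} {X : Ctx} {E : Finset ℕ} (hX : X.For I a δ)
include hX

omit hX in
theorem full_of_idle (h : I.Partial a E j) (hj : j < X.last)
    (hidle : I.early E j + I.p (j + 1) < I.C (j + 1) - I.k) : I.Full a X.last E j :=
  ⟨h, hj.le, fun _ => hidle⟩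

theorem extend_sound {e : Quad} {s : Table × Table} (he : IsLevel I a j e) (hj : j < X.last)
    (hs : Valid₂ I a X.last X.grid (j + 1) s) :
    Valid₂ I a X.last X.grid (j + 1) (extend X e s).val := by
  obtain ⟨E, hE, rfl⟩ := he
  rw [hX.extend_val hE hj]
  have h1 := hs.1.save (e := quadOf I a E (j + 1)) ⟨E, hE.skip, rfl⟩
  constructor
  · dsimp only
    split
    · rename_i hc
      exact h1.save ⟨_, hE.insert hc.1 hc.2, rfl⟩
    · exact h1
  · dsimp only
    split
    · rename_i hc
      exact hs.2.save ⟨E, j, full_of_idle hE hj hc.1, rfl⟩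
    · exact hs.2

/-- The disjunction is the statement carried through a scan: each extension only saves further
quadruples, and saving keeps boxes covered. -/
theorem extend_preserves {e : Quad} {s : Table × Table} {E₀ : Finset ℕ} {D B : ℝ}
    (he : IsLevel I a j e) (hj : j < X.last)
    (hs : CoversLevel I a X.grid E₀ (j + 1) D s.1 ∨ CoversFull I a X.last X.grid B s.2) :
    CoversLevel I a X.grid E₀ (j + 1) D (extend X e s).val.1 ∨
      CoversFull I a X.last X.grid B (extend X e s).val.2 := by
  obtain ⟨E, hE, rfl⟩ := he
  rw [hX.extend_val hE hj]
  refine hs.imp (fun h => ?_) (fun h => ?_)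
  · dsimp only
    split
    · exact (h.save _).save _
    · exact h.save _
  · dsimp only
    split
    · exact h.save _
    · exact h

/-- From a quadruple near the partial schedule of a feasible schedule `S`, a quadruple near the next
partial schedule, or a full schedule whose cost is near that of `S`, is generated. -/
theorem extend_covers {e : Quad} {s : Table × Table} {S : ℕ → ℝ} {D : ℝ} (hD : 1 ≤ D)
    (hF : I.Feasible S) (he : IsLevel I a j e) (hj : j < X.last)
    (hnear : Near I (I.earlyJobs S) j D e) :
    CoversLevel I a X.grid (I.earlyJobs S) (j + 1) D (extend X e s).val.1 ∨
      CoversFull I a X.last X.grid (D * I.cost S) (extend X e s).val.2 := by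
  obtain ⟨E, hE, rfl⟩ := he
  have hlast := hX.setup.last_le
  have hV := hX.setup.valid
  obtain ⟨n1, n2, n3⟩ := hnear
  simp only [quadOf] at n1 n2 n3
  have hp : (0 : ℝ) ≤ I.p (j + 1) := Nat.cast_nonneg _
  have hw : (0 : ℝ) ≤ I.w (j + 1) := Nat.cast_nonneg _
  rw [hX.extend_val hE hj]
  by_cases hmem : j + 1 ∈ I.earlyJobs S
  · have hT := Inst.early_earlyJobs_le hV hF (show j + 1 ≤ I.n by omega)
    have hC := Inst.C_sub_le_of_mem_earlyJobs hF hmem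
    have he' : I.early (I.earlyJobs S) (j + 1) = I.early (I.earlyJobs S) j + I.p (j + 1) := by
      rw [Inst.early_succ, if_pos hmem]
    by_cases hclose : I.C (j + 1) - I.k ≤ I.early E j + I.p (j + 1)
    · left
      -- The early jobs of `S` fit before `T₁`, and the quadruple has used no more time than they
      -- have.
      have hfit : I.early E j + I.p (j + 1) ≤ I.T₁ := by linarith
      rw [if_pos ⟨hfit, hclose⟩]
      dsimp only
      refine ⟨quadOf I a (insert (j + 1) E) (j + 1), ⟨_, hE.insert hfit hclose, rfl⟩,
        covers_save_self X.grid _ (quadOf I a (insert (j + 1) E) (j + 1)), ?_, ?_, ?_⟩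
      · simp only [quadOf, Inst.early_succ, Finset.mem_insert_self, if_true, hmem,
          Inst.early_insert le_rfl]
        linarith
      · simp only [quadOf, Inst.late_succ, Finset.mem_insert_self, if_true, hmem,
          Inst.late_insert le_rfl, add_zero]
        exact n2
      · simp only [quadOf, Inst.partialCost_succ, Inst.compl, Finset.mem_insert_self, if_true, hmem,
          Inst.partialCost_insert le_rfl, Inst.early_succ, Inst.early_insert le_rfl]
        have h0 := I.early_nonneg (I.earlyJobs S) j
        have h1 : I.early E j + I.p (j + 1) ≤ D * (I.early (I.earlyJobs S) j + I.p (j + 1)) := by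
          nlinarith
        nlinarith [mul_le_mul_of_nonneg_left h1 hw]
    -- Here the job would complete too early. As it is early in `S`, its earliest permitted
    -- completion time is at most `T₁`, so case 3 applies.
    · right
      rw [not_le] at hclose
      have hidle := And.intro hclose hC
      rw [if_pos hidle]
      dsimp only
      have hfull := full_of_idle hE hj hclose
      refine ⟨fullOf I a X.last E j, ⟨E, j, hfull, rfl⟩,
        covers_save_self X.grid _ (fullOf I a X.last E j), ?_⟩
      -- The new full schedule is compared with the lower bound for `S` split at `j`, even if `S`
      -- makes some of the later jobs up to `last` late.
      refine (Inst.fullCost_le_mul hD hj.le hlast n2 n3 fun i h1 h2 => ?_).trans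
        (mul_le_mul_of_nonneg_left (Inst.fullCost_le_cost hV hF hj.le hX.setup.beyond) (by linarith))
      have := I.C_mono (show j + 1 ≤ i from h1)
      linarith [I.early_nonneg E j]
  · left
    have hn := hE.succ_notMem
    have key : CoversLevel I a X.grid (I.earlyJobs S) (j + 1) D
        (Timed.val (save X.grid s.1 (quadOf I a E (j + 1)))) := by
      refine ⟨quadOf I a E (j + 1), ⟨_, hE.skip, rfl⟩,
        covers_save_self X.grid _ (quadOf I a E (j + 1)), ?_, ?_, ?_⟩
      · simp only [quadOf, Inst.early_succ, hn, hmem, if_false, add_zero]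
        exact n1
      · simp only [quadOf, Inst.late_succ, hn, hmem, if_false]
        nlinarith
      · simp only [quadOf, Inst.partialCost_succ, Inst.compl, Inst.late_succ, hn, hmem, if_false]
        have h1 : I.late E j + I.p (j + 1) ≤ D * (I.late (I.earlyJobs S) j + I.p (j + 1)) := by
          nlinarith
        nlinarith [mul_le_mul_of_nonneg_left h1 hw]
    dsimp only
    split
    · exact key.save _
    · exact key

/-- Storing loses a factor `δ`. -/
theorem exists_stored_near {T : Table} {E₀ : Finset ℕ} {D : ℝ} (hj : j ≤ X.last)
    (hT : Sound X.grid (IsLevel I a j) T) (h : CoversLevel I a X.grid E₀ j D T) :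
    ∃ e, Stored X.grid T e ∧ IsLevel I a j e ∧ Near I E₀ j (D * δ) e := by
  obtain ⟨e, ⟨E, hE, rfl⟩, hc, hn⟩ := h
  obtain ⟨e', h1, ⟨E', hE', rfl⟩, h3, h4, h5⟩ := hc.exists_stored hT (hX.quad_fits hE hj)
  have hδ := hX.one_lt
  have h6 := hX.le_of_cell₂_eq (hX.L₂_le hE) (hX.L₂_le hE') h4
  have h7 := hX.le_of_cell₃_eq (hX.L₃_le hE) (hX.L₃_le hE') h5
  refine ⟨_, h1, ⟨E', hE', rfl⟩, h3.trans hn.ℓ₁, h6.trans ?_, h7.trans ?_⟩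
  · rw [mul_comm D, mul_assoc]
    exact mul_le_mul_of_nonneg_left hn.ℓ₂ (by linarith)
  · rw [mul_comm D, mul_assoc]
    exact mul_le_mul_of_nonneg_left hn.Z (by linarith)

theorem exists_stored_full {T : Table} {B : ℝ} (hT : Sound X.grid (IsFull I a X.last) T)
    (h : CoversFull I a X.last X.grid B T) :
    ∃ e, Stored X.grid T e ∧ e.Z ≤ δ * B := by
  obtain ⟨e, ⟨E, j, hE, rfl⟩, hc, hn⟩ := h
  obtain ⟨e', h1, ⟨E', j', hE', rfl⟩, h3, h4, h5⟩ := hc.exists_stored hT (hX.full_fits hE)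
  have hL : ∀ {E j}, I.Full a X.last E j → X.grid.L₃ ≤ I.fullCost E j X.last := fun h =>
    (hX.L₃_le h.toPartial).trans (Inst.partialCost_le_fullCost h hX.setup.last_le)
  have h7 := hX.le_of_cell₃_eq (e := fullOf I a X.last E j) (hL hE) (hL hE') h5
  exact ⟨_, h1, h7.trans (mul_le_mul_of_nonneg_left hn (by linarith [hX.one_lt]))⟩

end Ctx.For

/-- One level of the dynamic program. -/
noncomputable def level (X : Ctx) : Table × Table → Timed (Table × Table) := fun s => do
  let next ← newTable X.grid
  scan X.grid s.1 (extend X) (next, s.2)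

theorem level_val (X : Ctx) (s : Table × Table) : (level X s).val =
    (scan X.grid s.1 (extend X) ((newTable X.grid).val, s.2)).val := rfl

/-- The tables after the level of `J_a`. -/
noncomputable def startTables (a : ℕ) (X : Ctx) : Table × Table :=
  ((save X.grid (newTable X.grid).val
    { j := a, ℓ₁ := X.pre.P (a - 1), ℓ₂ := X.grid.L₂, Z := X.grid.L₃, comp := [X.grid.L₂] }).val,
    (newTable X.grid).val)

noncomputable def levelTables (a : ℕ) (X : Ctx) : Table × Table :=
  (loop a (X.last - a) (fun _ => level X) (startTables a X)).val

noncomputable def fullTable (a : ℕ) (X : Ctx) : Table :=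
  (scan X.grid (levelTables a X).1 (complete X) (levelTables a X).2).val

noncomputable def bestQuad (a : ℕ) (X : Ctx) : Option Quad :=
  (scan X.grid (fullTable a X) selectMin none).val

/-- What holds after `d` levels with respect to a feasible schedule `S`. -/
def Progress (I : Inst) (a d : ℕ) (δ : ℝ) (X : Ctx) (S : ℕ → ℝ) (s : Table × Table) : Prop :=
  (∃ e, Stored X.grid s.1 e ∧ IsLevel I a (a + d) e ∧ Near I (I.earlyJobs S) (a + d) (δ ^ d) e) ∨
    CoversFull I a X.last X.grid (δ ^ d * I.cost S) s.2

namespace Ctx.For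

variable {I : Inst} {a j : ℕ} {δ : ℝ} {X : Ctx} {E : Finset ℕ} (hX : X.For I a δ)
include hX

theorem startTables_eq (hE : I.Partial a E j) : startTables a X =
    ((save X.grid (newTable X.grid).val (quadOf I a E a)).val, (newTable X.grid).val) := by
  have ha := hX.setup.one_le
  have hl := hE.late_a ha
  have hearly : I.early E a = I.C (a - 1) := by
    obtain ⟨b, rfl⟩ : ∃ b, a = b + 1 := ⟨a - 1, by omega⟩
    rw [Inst.early_succ, if_neg hE.notMem, add_zero, hE.early_before b (by omega)]
    rfl
  have hcomp : compList I a E a = [X.grid.L₂] := by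
    simp [compList, hX.L₂_eq, Inst.compl, hE.notMem, hl, List.range_one]
  unfold startTables quadOf
  rw [hcomp, hearly, hl, hX.partialCost_a hE, hX.L₂_eq,
    hX.preP _ (by have := hX.setup.le_n; omega)]

theorem startTables_valid : Valid₂ I a X.last X.grid a (startTables a X) := by
  have h := Inst.Partial.start hX.setup
  rw [hX.startTables_eq h]
  have hs := (sound_empty X.grid (IsLevel I a a)).save (e := quadOf I a (Finset.Icc 1 (a - 1)) a)
    ⟨_, h, rfl⟩
  exact And.intro hs (sound_empty X.grid _)

theorem mem_earlyJobs_before {S : ℕ → ℝ} (hS : I.StartsLater a S) {i : ℕ} (h1 : 1 ≤ i)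
    (hi : i < a) : i ∈ I.earlyJobs S :=
  Inst.mem_earlyJobs.2 ⟨⟨h1, hi.le.trans hX.setup.le_n⟩, hS.earlier i h1 hi⟩

theorem a_notMem_earlyJobs {S : ℕ → ℝ} (hS : I.StartsLater a S) : a ∉ I.earlyJobs S := by
  intro h
  have h1 := (Inst.mem_earlyJobs.1 h).2
  have h2 : (I.T₁ : ℝ) < I.T₂ := by exact_mod_cast hX.setup.valid.T₁_lt_T₂
  have h3 := hX.p_a_pos
  rw [hS.start_eq] at h1
  linarith

/-- The first level costs no factor `δ`: its table was empty, so the box holds the starting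
quadruple itself, which agrees with `S` up to `J_a`. -/
theorem startTables_progress {S : ℕ → ℝ} (hS : I.StartsLater a S) :
    Progress I a 0 δ X S (startTables a X) := by
  left
  have h := Inst.Partial.start hX.setup
  have hcongr : ∀ i, 1 ≤ i → i ≤ a →
      (i ∈ Finset.Icc 1 (a - 1) ↔ i ∈ I.earlyJobs S) := by
    intro i h1 h2
    rcases h2.eq_or_lt with rfl | h2
    · exact iff_of_false (by simp; omega) (hX.a_notMem_earlyJobs hS)
    · exact iff_of_true (Finset.mem_Icc.2 ⟨h1, by omega⟩) (hX.mem_earlyJobs_before hS h1 h2)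
  have hw : ∀ e : Quad, (save X.grid (newTable X.grid).val e).val =
      (writeCell (newTable X.grid).val (X.grid.cell₁ e) (X.grid.cell₂ e) (X.grid.cell₃ e) e).val :=
    fun e => by rw [save_val]; rfl
  have hf := hX.quad_fits h hX.setup.le_last
  refine ⟨quadOf I a (Finset.Icc 1 (a - 1)) a, ⟨_, _, _, hf.le₁, one_le_locate _ _ _, hf.le₂,
    one_le_locate _ _ _, hf.le₃, ?_⟩, ⟨_, h, rfl⟩, ?_, ?_, ?_⟩
  · rw [hX.startTables_eq h, hw]
    dsimp only
    rw [writeCell_apply, if_pos ⟨rfl, rfl, rfl⟩]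
  · exact (Inst.early_congr hcongr).le
  · rw [pow_zero, one_mul]
    exact (Inst.late_congr hcongr).le
  · rw [pow_zero, one_mul]
    exact (Inst.partialCost_congr hcongr).le

theorem level_valid {s : Table × Table} (hj : j < X.last)
    (hs : Valid₂ I a X.last X.grid j s) :
    Valid₂ I a X.last X.grid (j + 1) (level X s).val := by
  rw [level_val]
  exact scan_invariant (Valid₂ I a X.last X.grid (j + 1)) ⟨sound_empty _ _, hs.2⟩
    fun e s' he hs' => hX.extend_sound (he.good hs.1) hj hs'

/-- During the scan nothing is lost; the factor `δ` enters when the quadruple found in the box of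
the next level replaces the generated one. Full schedules lose it only when the full table is read,
so on that side the bound is merely weakened. -/
theorem level_progress {s : Table × Table} {S : ℕ → ℝ} (hF : I.Feasible S) {d : ℕ}
    (hd : a + d < X.last) (hs : Valid₂ I a X.last X.grid (a + d) s)
    (h : Progress I a d δ X S s) (hcost : 0 ≤ I.cost S) :
    Progress I a (d + 1) δ X S (level X s).val := by
  have hδ := hX.one_lt
  have hD : 1 ≤ δ ^ d := one_le_pow₀ hδ.le
  have hv := hX.level_valid hd hs
  have key : CoversLevel I a X.grid (I.earlyJobs S) (a + d + 1) (δ ^ d) (level X s).val.1 ∨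
      CoversFull I a X.last X.grid (δ ^ d * I.cost S) (level X s).val.2 := by
    rw [level_val]
    rcases h with ⟨e, he, hl, hn⟩ | h
    · exact scan_reach (fun _ => True)
        (fun s : Table × Table => CoversLevel I a X.grid (I.earlyJobs S) (a + d + 1) (δ ^ d) s.1 ∨
          CoversFull I a X.last X.grid (δ ^ d * I.cost S) s.2) trivial (fun _ _ _ _ => trivial)
        (fun e' s' he' _ hq => hX.extend_preserves (he'.good hs.1) hd hq) he
        (fun s' _ => hX.extend_covers hD hF hl hd hn)
    · exact scan_invariant (fun s : Table × Table =>
          CoversLevel I a X.grid (I.earlyJobs S) (a + d + 1) (δ ^ d) s.1 ∨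
          CoversFull I a X.last X.grid (δ ^ d * I.cost S) s.2) (Or.inr h)
        (fun e' s' he' hq => hX.extend_preserves (he'.good hs.1) hd hq)
  rcases key with h | ⟨e, h1, h2, h3⟩
  · left
    rw [pow_succ]
    exact hX.exists_stored_near hd hv.1 h
  · right
    refine ⟨e, h1, h2, h3.trans ?_⟩
    gcongr
    · exact hδ.le
    · omega

theorem levelTables_valid : Valid₂ I a X.last X.grid X.last (levelTables a X) := by
  have hle := hX.setup.le_last
  have h := loop_induction (lo := a) (m := X.last - a) (body := fun _ => level X)
    (s := startTables a X) (fun d s => Valid₂ I a X.last X.grid (a + d) s) hX.startTables_valid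
    fun d s hd hs => hX.level_valid (j := a + d) (by omega) hs
  rwa [Nat.add_sub_cancel' hle] at h

theorem levelTables_progress {S : ℕ → ℝ} (hF : I.Feasible S) (hS : I.StartsLater a S)
    (hcost : 0 ≤ I.cost S) : Progress I a (X.last - a) δ X S (levelTables a X) :=
  (loop_induction (lo := a) (m := X.last - a) (body := fun _ => level X)
    (s := startTables a X) (fun d s => Valid₂ I a X.last X.grid (a + d) s ∧ Progress I a d δ X S s)
    ⟨hX.startTables_valid, hX.startTables_progress hS⟩
    fun d s hd hs => ⟨hX.level_valid (j := a + d) (by omega) hs.1,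
      hX.level_progress hF (by omega) hs.1 hs.2 hcost⟩).2

omit hX in
theorem full_last (h : I.Partial a E X.last) : I.Full a X.last E X.last :=
  ⟨h, le_rfl, fun h => absurd h (lt_irrefl _)⟩

theorem complete_sound {e : Quad} {T : Table} (he : IsLevel I a X.last e)
    (hT : Sound X.grid (IsFull I a X.last) T) :
    Sound X.grid (IsFull I a X.last) (complete X e T).val := by
  obtain ⟨E, hE, rfl⟩ := he
  rw [hX.complete_val]
  exact hT.save ⟨E, _, full_last hE, rfl⟩

theorem fullTable_sound : Sound X.grid (IsFull I a X.last) (fullTable a X) :=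
  scan_invariant _ hX.levelTables_valid.2 fun _ _ he hs =>
    hX.complete_sound (he.good hX.levelTables_valid.1) hs

theorem complete_preserves {e : Quad} {T : Table} {B : ℝ} (he : IsLevel I a X.last e)
    (hT : CoversFull I a X.last X.grid B T) :
    CoversFull I a X.last X.grid B (complete X e T).val := by
  obtain ⟨E, hE, rfl⟩ := he
  rw [hX.complete_val]
  exact hT.save _

theorem fullTable_covers {S : ℕ → ℝ} (hF : I.Feasible S) (hS : I.StartsLater a S)
    (hcost : 0 ≤ I.cost S) :
    CoversFull I a X.last X.grid (δ ^ (X.last - a) * I.cost S) (fullTable a X) := by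
  have hlev := hX.levelTables_valid.1
  have hD : 1 ≤ δ ^ (X.last - a) := one_le_pow₀ hX.one_lt.le
  rcases hX.levelTables_progress hF hS hcost with ⟨e, he, hl, hn⟩ | h
  · rw [Nat.add_sub_cancel' hX.setup.le_last] at hl hn
    refine scan_reach (fun _ => True) _ trivial (fun _ _ _ _ => trivial)
      (fun e' T he' _ hT => hX.complete_preserves (he'.good hlev) hT) he fun T _ => ?_
    obtain ⟨E, hE, rfl⟩ := hl
    rw [hX.complete_val]
    refine ⟨fullOf I a X.last E X.last, ⟨E, _, full_last hE, rfl⟩,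
      covers_save_self X.grid _ (fullOf I a X.last E X.last), ?_⟩
    exact (Inst.fullCost_le_mul hD le_rfl hX.setup.last_le hn.ℓ₂ hn.Z fun i h1 h2 => by
      omega).trans (mul_le_mul_of_nonneg_left
        (Inst.fullCost_le_cost hX.setup.valid hF le_rfl hX.setup.beyond) (by linarith))
  · exact scan_invariant _ h fun e' T he' hT => hX.complete_preserves (he'.good hlev) hT

theorem bestQuad_isFull {e : Quad} (h : bestQuad a X = some e) : IsFull I a X.last e := by
  have key := scan_invariant (G := X.grid) (T := fullTable a X) (f := selectMin) (s := none)
    (fun b => ∀ e, b = some e → IsFull I a X.last e) (by simp) fun e b he hb => by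
      have hg := he.good hX.fullTable_sound
      rcases b with - | b
      · intro e' h'
        obtain rfl : e = e' := by simpa [selectMin] using h'
        exact hg
      · change ∀ e', (Timed.val (if decide (e.Z < b.Z) = true then _ else _)) = some e' → _
        split
        · intro e' h'
          obtain rfl : e = e' := by simpa using h'
          exact hg
        · exact hb
  exact key e h

/-- The exponent counts one factor for each level after the first and one for the table of full
schedules. -/
theorem exists_bestQuad {S : ℕ → ℝ} (hF : I.Feasible S) (hS : I.StartsLater a S)
    (hcost : 0 ≤ I.cost S) :
    ∃ e, bestQuad a X = some e ∧ e.Z ≤ δ ^ (X.last - a + 1) * I.cost S := by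
  obtain ⟨e, he, hle⟩ := hX.exists_stored_full hX.fullTable_sound
    (hX.fullTable_covers hF hS hcost)
  rw [pow_succ', mul_assoc]
  refine scan_reach (fun _ => True) (fun b : Option Quad => ∃ e', b = some e' ∧
    e'.Z ≤ δ * (δ ^ (X.last - a) * I.cost S)) trivial (fun _ _ _ _ => trivial) ?_ he ?_
  · rintro e' - - - ⟨b, rfl, hb⟩
    change ∃ e'', Timed.val (if decide (e'.Z < b.Z) = true then _ else _) = some e'' ∧ _
    simp only [decide_eq_true_eq]
    split
    · exact ⟨e', rfl, by linarith⟩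
    · exact ⟨b, rfl, hb⟩
  · rintro b -
    rcases b with - | b
    · exact ⟨e, rfl, hle⟩
    · change ∃ e'', Timed.val (if decide (e.Z < b.Z) = true then _ else _) = some e'' ∧ _
      simp only [decide_eq_true_eq]
      split
      · exact ⟨e, rfl, hle⟩
      · exact ⟨b, rfl, by linarith⟩

/-- The schedule in which `J_1, …, J_{a-1}` keep their places and all other jobs follow at `T₂`. -/
theorem full_start : I.Full a X.last (Finset.Icc 1 (a - 1)) X.last := by
  refine full_last ?_
  have h := Inst.Partial.start hX.setup
  have key : ∀ d, I.Partial a (Finset.Icc 1 (a - 1)) (a + d) := fun d => by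
    induction d with
    | zero => exact h
    | succ d ih => exact ih.skip
  have := key (X.last - a)
  rwa [Nat.add_sub_cancel' hX.setup.le_last] at this

theorem exists_feasible : ∃ S, I.Feasible S ∧ I.StartsLater a S :=
  ⟨I.fullS _ _ _, hX.full_start.feasible hX.setup fun _ _ _ => rfl,
    hX.full_start.startsLater hX.setup fun _ _ _ => rfl⟩

end Ctx.For

/-! ### The returned schedule and the approximation ratio -/

theorem Inst.Feasible.cost_nonneg {I : Inst} {S : ℕ → ℝ} (hF : I.Feasible S) : 0 ≤ I.cost S :=
  Finset.sum_nonneg fun i hi => by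
    obtain ⟨h1, h2⟩ := Finset.mem_Icc.1 hi
    exact mul_nonneg (Nat.cast_nonneg _) (add_nonneg (hF.nonneg i h1 h2) (Nat.cast_nonneg _))

/-- The last step: the schedule of the best quadruple is recovered. -/
noncomputable def finish (X : Ctx) (a : ℕ) : Option Quad → Timed (Option Output)
  | none => pure none
  | some e => do
    let S ← backtrack X a e
    pure (some { value := e.Z, schedule := S })

theorem approx_val (I : Inst) (a : ℕ) (ε : ℝ) :
    (approx I a ε).val = (finish (ctxOf I a ε) a (bestQuad a (ctxOf I a ε))).val := by
  unfold approx
  simp only [val_bind, Timed.read, Timed.add, Timed.mul, Timed.div, Timed.ln, subN, maxN,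
    Timed.cons, bestQuad, fullTable, levelTables, startTables, ctxOf, gridOf, preOf]
  rfl

/-- `(1 + ε / 2n)^d ≤ 1 + ε` for `d ≤ n`. -/
theorem ratio_pow_le {ε : ℝ} (hε : 0 < ε) (hε1 : ε ≤ 1) {n d : ℕ} (hn : 1 ≤ n) (hd : d ≤ n) :
    (1 + ε / (2 * n)) ^ d ≤ 1 + ε := by
  have hn' : (0 : ℝ) < n := by exact_mod_cast hn
  have h0 : 0 ≤ ε / (2 * n) := by positivity
  calc (1 + ε / (2 * n)) ^ d ≤ (1 + ε / (2 * n)) ^ n := pow_le_pow_right₀ (by linarith) hd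
    _ ≤ Real.exp (ε / (2 * n)) ^ n := by
        gcongr
        linarith [Real.add_one_le_exp (ε / (2 * n))]
    _ = Real.exp (ε / 2) := by
        rw [← Real.exp_nat_mul]
        congr 1
        field_simp
    _ ≤ 1 + ε / 2 + (ε / 2) ^ 2 := by
        have := Real.abs_exp_sub_one_sub_id_le (x := ε / 2) (by rw [abs_of_pos] <;> linarith)
        linarith [(abs_le.1 this).2]
    -- For `ε ≤ 1` the square `ε² / 4` is at most `ε / 2`.
    _ ≤ 1 + ε := by nlinarith

theorem approx_correct (I : Inst) (a : ℕ) (ε : ℝ) (hI : I.Valid) (ha : I.Candidate a) (hε : 0 < ε)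
    (hε1 : ε ≤ 1) : ∃ out : Output, (approx I a ε).val = some out ∧
      I.Feasible out.schedule ∧ I.StartsLater a out.schedule ∧
      out.value = I.cost out.schedule ∧
      ∀ S : ℕ → ℝ, I.Feasible S → I.StartsLater a S →
        I.cost out.schedule ≤ (1 + ε) * I.cost S := by
  have hX := ctxOf_for hI ha hε
  -- Some feasible constrained schedule is needed to see that the output is not `none`.
  obtain ⟨S₀, hF₀, hS₀⟩ := hX.exists_feasible
  obtain ⟨e, he, -⟩ := hX.exists_bestQuad hF₀ hS₀ hF₀.cost_nonneg
  obtain ⟨E, j, hE, rfl⟩ := hX.bestQuad_isFull he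
  have hSS := fun i h1 h2 => hX.backtrack_val hE (i := i) h1 h2
  refine ⟨⟨_, _⟩, by rw [approx_val, he]; rfl, hE.feasible hX.setup hSS,
    hE.startsLater hX.setup hSS, Inst.fullCost_eq_cost hSS, fun S hF hS => ?_⟩
  obtain ⟨e', he', hle⟩ := hX.exists_bestQuad hF hS hF.cost_nonneg
  rw [he] at he'
  obtain rfl : _ = e' := Option.some.inj he'
  dsimp only
  rw [← Inst.fullCost_eq_cost hSS]
  refine hle.trans (mul_le_mul_of_nonneg_right ?_ hF.cost_nonneg)
  have h1 := hX.setup.one_le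
  have h2 := hX.setup.last_le
  have h3 := hX.setup.le_n
  -- The exponent `last - a + 1` is at most `n` because `1 ≤ a ≤ last ≤ n`.
  exact ratio_pow_le hε hε1 (h1.trans h3) (by omega)

/-! ### Running time -/

theorem appendLast_time (X : Ctx) (ℓ : ℝ) : (appendLast X ℓ).time = 13 := rfl

theorem case₁_time_le (X : Ctx) (j : ℕ) (pj wj : ℝ) (e : Quad) (T : Table) :
    (case₁ X j pj wj e T).time ≤ 23 := by
  have := save_time_le X.grid T ⟨j, e.ℓ₁, e.ℓ₂ + pj, e.Z + wj * (e.ℓ₂ + pj), (e.ℓ₂ + pj) :: e.comp⟩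
  simp only [case₁, Timed.add, Timed.mul, Timed.cons, time_bind]
  omega

theorem case₂_time_le (X : Ctx) (j : ℕ) (wj c : ℝ) (e : Quad) (T : Table) :
    (case₂ X j wj c e T).time ≤ 22 := by
  have := save_time_le X.grid T ⟨j, c, e.ℓ₂, e.Z + wj * c, c :: e.comp⟩
  simp only [case₂, Timed.add, Timed.mul, Timed.cons, time_bind]
  omega

theorem case₃_time_le (X : Ctx) (e : Quad) (T : Table) : (case₃ X e T).time ≤ 44 := by
  simp only [case₃, Timed.read, Timed.sub, Timed.add, Timed.mul, time_bind, appendLast_time]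
  refine le_trans (by
    iterate 13 apply Nat.add_le_add_left
    exact save_time_le _ _ _) ?_
  norm_num

theorem complete_time_le (X : Ctx) (e : Quad) (T : Table) : (complete X e T).time ≤ 33 := by
  simp only [complete, Timed.add, time_bind, appendLast_time]
  exact (Nat.add_le_add_left (Nat.add_le_add_left (save_time_le _ _ _) _) _).trans (by norm_num)

/-- The bound is `23 + 22 + 44` for the three cases plus ten primitive steps. -/
theorem extend_time_le (X : Ctx) (e : Quad) (s : Table × Table) : (extend X e s).time ≤ 99 := by
  simp only [extend, Timed.addN, Timed.read, Timed.add, Timed.sub, Timed.le, Timed.lt, time_bind]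
  have h1 := case₁_time_le X (e.j + 1) (X.p (e.j + 1)) (X.w (e.j + 1)) e s.1
  have h2 := case₂_time_le X (e.j + 1) (X.w (e.j + 1)) (e.ℓ₁ + X.p (e.j + 1)) e
    (case₁ X (e.j + 1) (X.p (e.j + 1)) (X.w (e.j + 1)) e s.1).val
  have h3 := case₃_time_le X e s.2
  split <;> simp only [time_bind, time_pure] <;> split <;> simp only [time_bind, time_pure] <;>
    refine le_trans (by
      with_reducible repeat' first
        | exact h1 | exact h2 | exact h3
        | apply Nat.add_le_add | exact le_rfl) (by norm_num : _ ≤ 99)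

theorem selectMin_time_le (e : Quad) (b : Option Quad) : (selectMin e b).time ≤ 1 := by
  rcases b with - | b
  · simp [selectMin]
  · change 1 + Timed.time (if decide (e.Z < b.Z) = true then _ else _) ≤ 1
    split <;> simp

theorem unwind_time (l : List ℝ) (j : ℕ) (A : ℕ → ℝ) : (unwind l j A).time = 2 * l.length := by
  induction l generalizing j A with
  | nil => rfl
  | cons c l ih =>
    change 1 + (1 + (unwind l (j - 1) (Function.update A j c)).time) = _
    rw [ih, List.length_cons]
    ring

theorem prepare_time_le (n : ℕ) (p w : ℕ → ℝ) (T₁ k : ℝ) :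
    (prepare n p w T₁ k).time ≤ 15 * n + 6 := by
  simp only [prepare, Timed.add, Timed.read, addN, newArray, time_bind]
  refine le_trans (by
    repeat' first
      | apply Nat.add_le_add
      -- One pass makes two reads, four arithmetic steps, three writes and two comparisons.
      | exact loop_time_le (c := 11) fun _ _ => le_of_eq rfl
      | exact le_rfl) ?_
  omega

theorem backtrack_time_le (X : Ctx) (a : ℕ) (e : Quad) (ha : a ≤ X.n)
    (he : e.comp.length ≤ X.n) (hj : X.last ≤ X.n) :
    (backtrack X a e).time ≤ 20 * X.n + 20 := by
  simp only [backtrack, Timed.sub, Timed.read, addN, subN, newArray, time_bind, unwind_time]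
  refine le_trans (by
    repeat' first
      | apply Nat.add_le_add
      | exact loop_time_le (c := 2) fun _ _ => le_of_eq rfl
      | exact loop_time_le (c := 3) fun _ _ => le_of_eq rfl
      | exact loop_time_le (c := 4) fun _ _ => le_of_eq rfl
      | exact le_rfl) ?_
  omega

/-- The number of boxes of a level. -/
def Grid.size (G : Grid) : ℕ := (G.m₁ + 1) * G.m₂ * G.m₃

theorem pieces_time (lnδ L U : ℝ) : (pieces lnδ L U).time = 5 := rfl

theorem approx_time (I : Inst) (a : ℕ) (ε : ℝ) : (approx I a ε).time =
    (prepare I.n (fun j => I.p j) (fun j => I.w j) I.T₁ I.k).time + (1 + (1 + (1 + (1 + (1 + (1 + (1 + (1 + (1 + (1 + (1 + (1 + (1 + (1 + (1 + (1 + (1 + (1 + (5 + (5 + (5 + (1 + (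
      (gridOf I a ε).size + ((gridOf I a ε).size + (1 + (
      (save (gridOf I a ε) (newTable (gridOf I a ε)).val
        { j := a, ℓ₁ := (preOf I).P (a - 1), ℓ₂ := (gridOf I a ε).L₂, Z := (gridOf I a ε).L₃,
          comp := [(gridOf I a ε).L₂] }).time + (1 + (
      (loop a ((ctxOf I a ε).last - a) (fun _ => level (ctxOf I a ε))
        (startTables a (ctxOf I a ε))).time + (
      (scan (gridOf I a ε) (levelTables a (ctxOf I a ε)).1 (complete (ctxOf I a ε))
        (levelTables a (ctxOf I a ε)).2).time + (
      (scan (gridOf I a ε) (fullTable a (ctxOf I a ε)) selectMin none).time +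
      (finish (ctxOf I a ε) a (bestQuad a (ctxOf I a ε))).time)))))))))))))))))))))))))))))) := by
  unfold approx
  simp only [time_bind, Timed.read, Timed.add, Timed.mul, Timed.div, Timed.ln, subN, maxN,
    Timed.cons, pieces_time, bestQuad, fullTable, levelTables, startTables, ctxOf, gridOf, preOf]
  rfl

theorem level_time_le (X : Ctx) (s : Table × Table) (h₂ : 1 ≤ X.grid.m₂) (h₃ : 1 ≤ X.grid.m₃) :
    (level X s).time ≤ 104 * X.grid.size := by
  -- The factor `103` is `99 + 4` per box; reserving the next table adds one more step per box.
  have h : (scan X.grid s.1 (extend X) ((newTable X.grid).val, s.2)).time ≤ 103 * X.grid.size :=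
    scan_time_le h₂ h₃ (extend_time_le X)
  have e : (level X s).time = X.grid.size +
    (scan X.grid s.1 (extend X) ((newTable X.grid).val, s.2)).time := rfl
  omega

theorem Ctx.For.finish_time_le {X : Ctx} {I : Inst} {a : ℕ} {δ : ℝ} (hX : X.For I a δ) :
    (finish X a (bestQuad a X)).time ≤ 20 * I.n + 20 := by
  rcases h : bestQuad a X with - | e
  · exact Nat.zero_le _
  · obtain ⟨E, j, hE, rfl⟩ := hX.bestQuad_isFull h
    have h1 := hE.le_last
    have h2 := hX.setup.last_le
    have h3 := hX.setup.one_le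
    have h4 := hX.setup.le_n
    have hn := hX.n_eq
    have hlen : (fullOf I a X.last E j).comp.length = j + 1 - a := compList_length
    have ht := backtrack_time_le X a (fullOf I a X.last E j) (by omega) (by omega) (by omega)
    rw [hn] at ht
    exact ht

/-- Since `n` and the number of boxes are at least `1`, every contribution is at most a constant
times their product; the dominant one is the loop over the levels. -/
theorem approx_time_le (I : Inst) (a : ℕ) (ε : ℝ) (hI : I.Valid) (ha : I.Candidate a)
    (hε : 0 < ε) : (approx I a ε).time ≤ 300 * (I.n * (gridOf I a ε).size) := by
  have hX := ctxOf_for hI ha hε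
  have hn : 1 ≤ I.n := hX.setup.one_le.trans hX.setup.le_n
  have h₂ : 1 ≤ (gridOf I a ε).m₂ := Nat.le_add_left _ _
  have h₃ : 1 ≤ (gridOf I a ε).m₃ := Nat.le_add_left _ _
  have hN : 1 ≤ (gridOf I a ε).size := Nat.mul_pos (Nat.mul_pos (Nat.succ_pos _) h₂) h₃
  have t1 := prepare_time_le I.n (fun j => I.p j) (fun j => I.w j) I.T₁ I.k
  have t2 := save_time_le (gridOf I a ε) (newTable (gridOf I a ε)).val
    { j := a, ℓ₁ := (preOf I).P (a - 1), ℓ₂ := (gridOf I a ε).L₂, Z := (gridOf I a ε).L₃,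
      comp := [(gridOf I a ε).L₂] }
  have t3 : (loop a ((ctxOf I a ε).last - a) (fun _ => level (ctxOf I a ε))
      (startTables a (ctxOf I a ε))).time ≤ I.n * (104 * (gridOf I a ε).size + 1) :=
    (loop_time_le fun _ s => level_time_le (ctxOf I a ε) s h₂ h₃).trans
      (Nat.mul_le_mul_right _ ((Nat.sub_le _ _).trans hX.setup.last_le))
  have t4 : (scan (gridOf I a ε) (levelTables a (ctxOf I a ε)).1 (complete (ctxOf I a ε))
      (levelTables a (ctxOf I a ε)).2).time ≤ 37 * (gridOf I a ε).size :=
    scan_time_le (G := gridOf I a ε) (c := 33) h₂ h₃ (complete_time_le (ctxOf I a ε))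
  have t5 : (scan (gridOf I a ε) (fullTable a (ctxOf I a ε)) selectMin none).time ≤
      5 * (gridOf I a ε).size :=
    scan_time_le (G := gridOf I a ε) (c := 1) h₂ h₃ selectMin_time_le
  have t6 := hX.finish_time_le
  rw [approx_time]
  refine le_trans (by
    with_reducible repeat' first
      | exact t1 | exact t2 | exact t3 | exact t4 | exact t5 | exact t6
      | apply Nat.add_le_add | exact le_rfl) ?_
  generalize (gridOf I a ε).size = N at *
  have h6 : N ≤ I.n * N := Nat.le_mul_of_pos_left _ hn
  have h7 : I.n ≤ I.n * N := Nat.le_mul_of_pos_right _ hN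
  have h8 : I.n * (104 * N + 1) = 104 * (I.n * N) + I.n := by ring
  rw [h8]
  linarith

/-! ### The number of boxes -/

theorem half_le_log_of_two_le {V : ℝ} (hV : 2 ≤ V) : 1 / 2 ≤ Real.log V := by
  have h1 := Real.log_two_gt_d9
  have h2 := Real.log_le_log two_pos hV
  linarith

/-- With `log (1 + x) ≥ x / 2` the floor is at most `4 (n / ε) log V`. The two additional units are
absorbed by the same quantity, as `n / ε ≥ 1` and `log V ≥ 1 / 2`. -/
theorem pieces_add_one_le {ε : ℝ} {n : ℕ} (hn : 1 ≤ n) (hε : 0 < ε) (hε1 : ε ≤ 1) {L U V : ℝ}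
    (hL : 1 ≤ L) (hU : 0 < U) (hUV : U ≤ V) (hV : 2 ≤ V) :
    ((pieces (Real.log (1 + ε / (2 * n))) L U).val : ℝ) + 1 ≤ 8 * (n / ε) * Real.log V := by
  have hn' : (1 : ℝ) ≤ n := by exact_mod_cast hn
  have hlogV := half_le_log_of_two_le hV
  have hR : 1 ≤ (n : ℝ) / ε := by
    rw [le_div_iff₀ hε]
    linarith
  set x := ε / (2 * n) with hx
  have hx0 : 0 < x := by positivity
  have hx1 : x ≤ 1 := by
    rw [hx, div_le_iff₀ (by positivity)]
    linarith
  -- This follows from `log y ≥ 1 - 1 / y`, which at `y = 1 + x` is `x / (1 + x) ≥ x / 2` for `x ≤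
  -- 1`.
  have hlog : x / 2 ≤ Real.log (1 + x) := by
    have h := Real.one_sub_inv_le_log_of_pos (show 0 < 1 + x by linarith)
    refine le_trans ?_ h
    rw [le_sub_iff_add_le, ← le_sub_iff_add_le', inv_le_comm₀ (by linarith) (by linarith),
      inv_le_iff_one_le_mul₀ (by linarith)]
    nlinarith
  have hlogpos : 0 < Real.log (1 + x) := by linarith
  have hq : Real.log (U / L) ≤ Real.log V :=
    Real.log_le_log (div_pos hU (by linarith)) ((div_le_self hU.le hL).trans hUV)
  have hfloor : ((⌊Real.log (U / L) / Real.log (1 + x)⌋₊ : ℕ) : ℝ) ≤ 4 * (n / ε) * Real.log V := by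
    refine (Nat.cast_le.2 (Nat.floor_mono (b := 4 * (n / ε) * Real.log V) ?_)).trans
      (Nat.floor_le (by positivity))
    rw [div_le_iff₀ hlogpos]
    have h1 : 4 * (n / ε) * (x / 2) = 1 := by
      rw [hx]
      field_simp
      norm_num
    calc Real.log (U / L) ≤ Real.log V := hq
      _ = 4 * (n / ε) * (x / 2) * Real.log V := by rw [h1, one_mul]
      _ ≤ 4 * (n / ε) * Real.log (1 + x) * Real.log V := by gcongr
      _ = 4 * (n / ε) * Real.log V * Real.log (1 + x) := by ring
  have e : (pieces (Real.log (1 + x)) L U).val = ⌊Real.log (U / L) / Real.log (1 + x)⌋₊ + 1 := rfl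
  rw [e]
  push_cast
  nlinarith

/-- The upper end is at most `W P + W T₂`, and `W P` need not be bounded by a constant times `w_max
P`. But `W ≤ n w_max ≤ w_max P` gives `W P ≤ (w_max P)²`; the square costs only a factor `2` after
taking logarithms. -/
theorem U₃_le (I : Inst) (hI : I.Valid) :
    I.zSum I.n + I.wSum I.n * I.T₂ ≤ ((I.wMax : ℝ) * I.P + I.W * I.T₂) ^ 2 ∧
      2 ≤ (I.wMax : ℝ) * I.P + I.W * I.T₂ := by
  obtain ⟨i₀, h1, h2, -⟩ := hI.pMin_le
  have hn : 1 ≤ I.n := h1.trans h2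
  have hw : ∀ i ∈ Finset.Icc 1 I.n, I.w i ≤ I.wMax := fun i hi => Finset.le_sup (f := I.w) hi
  have hwMax : 1 ≤ I.wMax := (hI.w_pos i₀ h1 h2).trans_le (hw i₀ (Finset.mem_Icc.2 ⟨h1, h2⟩))
  have hnP : I.n ≤ I.P := by
    have := Finset.card_nsmul_le_sum (Finset.Icc 1 I.n) I.p 1 fun i hi =>
      hI.p_pos i (Finset.mem_Icc.1 hi).1 (Finset.mem_Icc.1 hi).2
    simpa [Inst.P] using this
  have hnW : I.n ≤ I.W := by
    have := Finset.card_nsmul_le_sum (Finset.Icc 1 I.n) I.w 1 fun i hi =>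
      hI.w_pos i (Finset.mem_Icc.1 hi).1 (Finset.mem_Icc.1 hi).2
    simpa [Inst.W] using this
  have hWn : I.W ≤ I.n * I.wMax := by
    have := Finset.sum_le_card_nsmul (Finset.Icc 1 I.n) I.w _ hw
    simpa [Inst.W] using this
  have hT : 1 ≤ I.T₂ := Nat.one_le_of_lt hI.T₁_lt_T₂
  have hz : I.zSum I.n ≤ (I.W : ℝ) * I.P := by
    rw [← Inst.C_n, Inst.W, Nat.cast_sum, Finset.sum_mul]
    exact Finset.sum_le_sum fun i hi => mul_le_mul_of_nonneg_left
      (I.C_mono (Finset.mem_Icc.1 hi).2) (Nat.cast_nonneg _)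
  have hwS : I.wSum I.n = I.W := by simp [Inst.wSum, Inst.W]
  have hWP : I.W ≤ I.wMax * I.P := by nlinarith
  have hA : 1 ≤ I.wMax * I.P := Nat.mul_pos hwMax (hn.trans hnP)
  have hB : 1 ≤ I.W * I.T₂ := Nat.mul_pos (hn.trans hnW) hT
  have hP : I.P ≤ I.wMax * I.P := Nat.le_mul_of_pos_left _ hwMax
  have main : I.W * I.P + I.W * I.T₂ ≤ (I.wMax * I.P + I.W * I.T₂) ^ 2 := by
    have := Nat.mul_le_mul hWP hP
    nlinarith
  constructor
  · rw [hwS]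
    have : (I.W : ℝ) * I.P + I.W * I.T₂ ≤ ((I.wMax : ℝ) * I.P + I.W * I.T₂) ^ 2 := by
      exact_mod_cast main
    linarith
  · exact_mod_cast add_le_add hA hB

/-- The spare unit in `pieces_add_one_le` pays for the extra box `[0, 0]` of the first coordinate
and is dropped in the other two. The maximum with `2` keeps the first logarithm away from zero when
`T₁ = 1`. -/
theorem size_le (I : Inst) (a : ℕ) (ε : ℝ) (hI : I.Valid) (ha : I.Candidate a) (hε : 0 < ε)
    (hε1 : ε ≤ 1) : ((gridOf I a ε).size : ℝ) ≤
      (8 * (I.n / ε) * Real.log (max 2 (I.T₁ : ℝ))) * (8 * (I.n / ε) * Real.log ((I.T₂ : ℝ) + I.P)) *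
        (8 * (I.n / ε) * (2 * Real.log ((I.wMax : ℝ) * I.P + I.W * I.T₂))) := by
  have hX := ctxOf_for hI ha hε
  have hn : 1 ≤ I.n := hX.setup.one_le.trans hX.setup.le_n
  obtain ⟨i₀, h1, h2, h3⟩ := hI.pMin_le
  have hp := hI.p_pos i₀ h1 h2
  have hT₁ : (1 : ℝ) ≤ I.T₁ := by exact_mod_cast hp.trans_le h3
  have hT₂ : (1 : ℝ) ≤ I.T₂ := by exact_mod_cast Nat.one_le_of_lt hI.T₁_lt_T₂
  have hP : (1 : ℝ) ≤ I.P := by exact_mod_cast Nat.one_le_of_lt hI.T₁_lt_P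
  have hL₁ : 1 ≤ (gridOf I a ε).L₁ := by
    obtain ⟨i, h4, h5, h6⟩ := (preOf_upTo I).pMin_eq
    change 1 ≤ (preOf I).pMin
    rw [h6]
    exact_mod_cast hI.p_pos i h4 (h5.trans (by omega))
  have hL₂ : 1 ≤ (gridOf I a ε).L₂ := by
    change 1 ≤ (I.T₂ : ℝ) + I.p a
    linarith [Nat.cast_nonneg (α := ℝ) (I.p a)]
  have hz : ∀ j, 0 ≤ I.zSum j := fun j =>
    Finset.sum_nonneg fun i _ => mul_nonneg (Nat.cast_nonneg _) (I.C_nonneg i)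
  have hL₃ : 1 ≤ (gridOf I a ε).L₃ := by
    refine le_trans ?_ hX.L₃_eq.ge
    have hw : (1 : ℝ) ≤ I.w a := by
      exact_mod_cast hI.w_pos a hX.setup.one_le hX.setup.le_n
    have := hz (a - 1)
    nlinarith [Nat.cast_nonneg (α := ℝ) (I.p a)]
  obtain ⟨hU, hQ⟩ := U₃_le I hI
  have hU₃ : 0 < I.zSum I.n + I.wSum I.n * I.T₂ := by
    have : I.w i₀ ≤ I.wSum I.n := by
      exact Finset.single_le_sum (f := fun i => (I.w i : ℝ)) (fun i _ => Nat.cast_nonneg _)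
        (Finset.mem_Icc.2 ⟨h1, h2⟩)
    have hw := hI.w_pos' h1 h2
    have := hz I.n
    nlinarith
  have b₁ := pieces_add_one_le hn hε hε1 hL₁ (by linarith) (le_max_right 2 (I.T₁ : ℝ))
    (le_max_left _ _)
  have b₂ := pieces_add_one_le hn hε hε1 hL₂ (U := I.T₂ + I.C I.n) (V := I.T₂ + I.P)
    (by rw [Inst.C_n]; linarith) (by rw [Inst.C_n]) (by linarith)
  have b₃ := pieces_add_one_le hn hε hε1 hL₃ hU₃ hU (by nlinarith)
  rw [Real.log_pow, Nat.cast_ofNat] at b₃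
  have e₁ : (gridOf I a ε).m₁ = _ := hX.m₁_eq
  have e₂ : (gridOf I a ε).m₂ = _ := hX.m₂_eq
  have e₃ : (gridOf I a ε).m₃ = _ := hX.m₃_eq
  rw [Grid.size]
  push_cast
  have c₁ : ((gridOf I a ε).m₁ : ℝ) + 1 ≤ _ := le_trans (by rw [e₁]; exact le_rfl) b₁
  have c₂ : ((gridOf I a ε).m₂ : ℝ) ≤ _ := le_trans (by rw [e₂]; exact (lt_add_one _).le) b₂
  have c₃ : ((gridOf I a ε).m₃ : ℝ) ≤ _ := le_trans (by rw [e₃]; exact (lt_add_one _).le) b₃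
  have hl := half_le_log_of_two_le (le_max_left 2 (I.T₁ : ℝ))
  have hl₂ := half_le_log_of_two_le (show 2 ≤ (I.T₂ : ℝ) + I.P by linarith)
  gcongr

end Resched

theorem theorem4p3 :
    (∀ (I : Resched.Inst) (a : ℕ) (ε : ℝ), I.Valid → I.Candidate a → 0 < ε → ε ≤ 1 →
      ∃ out : Resched.Output, (Resched.approx I a ε).val = some out ∧
        I.Feasible out.schedule ∧ I.StartsLater a out.schedule ∧
        out.value = I.cost out.schedule ∧
        ∀ S : ℕ → ℝ, I.Feasible S → I.StartsLater a S →
          I.cost out.schedule ≤ (1 + ε) * I.cost S) ∧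
    (∃ K : ℝ, ∀ (I : Resched.Inst) (a : ℕ) (ε : ℝ), I.Valid → I.Candidate a → 0 < ε → ε ≤ 1 →
      ((Resched.approx I a ε).time : ℝ) ≤
        K * ((I.n : ℝ) ^ 4 / ε ^ 3 * Real.log (max 2 (I.T₁ : ℝ)) *
          Real.log ((I.T₂ : ℝ) + I.P) *
          Real.log ((I.wMax : ℝ) * I.P + (I.W : ℝ) * I.T₂))) := by
  -- The constant is `300 · 8 · 8 · 16`: the time per level and box, and the factors of the three
  -- coordinates.
  refine ⟨Resched.approx_correct, 307200, fun I a ε hI ha hε hε1 => ?_⟩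
  have h1 : ((Resched.approx I a ε).time : ℝ) ≤ 300 * (I.n * (Resched.gridOf I a ε).size) := by
    exact_mod_cast Resched.approx_time_le I a ε hI ha hε
  refine h1.trans (le_trans (mul_le_mul_of_nonneg_left (mul_le_mul_of_nonneg_left
    (Resched.size_le I a ε hI ha hε hε1) (Nat.cast_nonneg _)) (by norm_num)) (le_of_eq ?_))
  field_simp
  ring
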